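/- **Setting.** Let $1\le d\le 3$, let $\mathcal O\subset\mathbb R^d$ be a nonempty bounded open convex domain with polygonal boundary, $L^2=L^2(\mathcal O;\mathbb R)$, and let $\Lambda$ be the Laplace operator with homogeneous Dirichlet boundary condition. Let $(e_i)_{i\ge1}$ be an orthonormal basis of $L^2$ with $-\Lambda e_i=\lambda_ie_i$, $0<\lambda_1\le\lambda_2\le\cdots$. Put $\dot{\mathbb H}^1=D((-\Lambda)^{1/2})$ with $\langle x,y\rangle_{\dot{\mathbb H}^1}=\sum_i\lambda_i\langle x,e_i\rangle_{L^2}\langle y,e_i\rangle_{L^2}$ and $\mathbb H^1=\dot{\mathbb H}^1\times L^2$. Let $\mathbf Q$ be a symmetric, positive definite operator of finite trace on $L^2$, and let $\mathcal L_2(\mathbf Q^{1/2}(L^2),L^2)$ be the space of Hilbert–Schmidt operators from $\mathbf Q^{1/2}(L^2)$, with norm $\|\mathbf Q^{1/2}x\|=\|x\|_{L^2}$, to $L^2$; its norm is written $\|\cdot\|_{\mathcal L_2}$. For $u\in\dot{\mathbb H}^1$ write $\Theta u=(u,\partial_{x_1}u,\dots,\partial_{x_d}u)$ with weak derivatives.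 Let $W=\sum_k\mathbf Q^{1/2}e_k\beta_k$ be a $\mathbf Q$-Wiener process with respect to a filtered probability space $(\Omega,\mathcal F,\{\mathcal F_t\}_{t\ge0},\mathbb P)$, with $\beta_k$ i.i.d. real Brownian motions. **Assumption 2.** Let $f:\dot{\mathbb H}^1\to L^2$, $g:\dot{\mathbb H}^1\times(L^2)^d\to\mathcal L_2(\mathbf Q^{1/2}(L^2),L^2)$, $k\in\mathbb N^+$. There are $c_2\ge0$ and polynomials $b_1,b_2,b_3$ of degrees (at most) $2k+1,2k,k$ such that for all $u,\tilde u\in\dot{\mathbb H}^1$ $$\|f(u)\|_{L^2}\le b_1(\|u\|_{\dot{\mathbb H}^1}),\qquad \|f(u)-f(\tilde u)\|_{L^2}\le b_2(\|u\|_{\dot{\mathbb H}^1},\|\tilde u\|_{\dot{\mathbb H}^1})\|u-\tilde u\|_{\dot{\mathbb H}^1},$$ $$\|g(\Theta u)\|_{\mathcal L_2}\le c_2(1+\|u\|_{L^{2k+2}}^{k+1}+\|u\|_{\dot{\mathbb H}^1}),\qquad \|g(\Theta u)-g(\Theta\tilde u)\|_{\mathcal L_2}\le b_3(\|u\|_{\dot{\mathbb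 H}^1},\|\tilde u\|_{\dot{\mathbb H}^1})\|u-\tilde u\|_{\dot{\mathbb H}^1}.$$ There is a differentiable $\widetilde F:\mathbb R\to\mathbb R$ with $f(u)=\widetilde F'(u)$ such that $F(u)=\int_{\mathcal O}\widetilde F(u(x))\,dx$ is finite on $\dot{\mathbb H}^1$, and there are constants $c_3,c_4,\delta_0>0$ with $F(u)+\delta_0\ge c_3\|u\|_{L^2}^2+c_4\|u\|_{L^{2k+2}}^{2k+2}$ for $u\in\dot{\mathbb H}^1$. Moreover $\delta_0$ is such that $F(u)+\delta_0\ge c$ for some $c>0$ and all $u\in\dot{\mathbb H}^1$. **Schemes.** Let $T>0$, $N\tau=T$, $t_n=n\tau$, $\delta W_n=W(t_{n+1})-W(t_n)$, let $X_0=(u_0,v_0)$ be $\mathcal F_0$-measurable with values in $\mathbb H^1$, and $q_0=\sqrt{F(u_0)+\delta_0}$. Let $\widehat u_n=u_n$ for all $n$, or $\widehat u_n=\frac{3u_n-u_{n-1}}2$ for all $n$ with $u_{-1}=u_0$. Here $g(\Theta u_n)\delta W_n=\sum_k(\beta_k(t_{n+1})-\beta_k(t_n))\,g(\Theta u_n)\mathbf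 Q^{1/2}e_k$, the limit being in probability in $L^2$. The midpoint SAV scheme is $$u_{n+1}=u_n+\tfrac\tau2(v_n+v_{n+1})+\tfrac\tau2g(\Theta u_n)\delta W_n,$$ $$v_{n+1}=v_n+\tfrac\tau2\Lambda(u_n+u_{n+1})-\tau\frac{f(\widehat u_n)}{\sqrt{F(\widehat u_n)+\delta_0}}\frac{q_n+q_{n+1}}2+g(\Theta u_n)\delta W_n,$$ $$q_{n+1}=q_n+\frac{\langle f(\widehat u_n),u_{n+1}-u_n\rangle_{L^2}}{2\sqrt{F(\widehat u_n)+\delta_0}},$$ where the second equation holds in $\dot{\mathbb H}^{-1}$, the dual of $\dot{\mathbb H}^1$. With $X_n=(u_n,v_n)^\top$, $A=\begin{bmatrix}0&I\\\Lambda&0\end{bmatrix}$ and $E(t)=\exp(tA)$, the exponential Euler SAV scheme is $$X_{n+1}=E(\tau)X_n+A^{-1}(E(\tau)-I)\Big(0,-\frac{f(\widehat u_n)}{\sqrt{F(\widehat u_n)+\delta_0}}\frac{q_n+q_{n+1}}2\Big)^\top+E(\tau)\big(0,g(\Theta u_n)\delta W_n\big)^\top$$ with the same equation for $q_{n+1}$.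 All equations hold almost surely, for $n\in\{0,\dots,N-1\}$, with $u_n\in\dot{\mathbb H}^1$, $v_n\in L^2$, $q_n\in\mathbb R$. **Proposition.** Let $(u_n,v_n,q_n)_{0\le n\le N}$ solve either scheme, with either choice of $\widehat u_n$, and let $V(u,v,q)=\frac12\|u\|_{\dot{\mathbb H}^1}^2+\frac12\|v\|_{L^2}^2+q^2$. Then for $n\in\{0,1,\dots,N-1\}$ $$\mathbb E[V(u_{n+1},v_{n+1},q_{n+1})]=\mathbb E[V(u_n,v_n,q_n)]+\frac\tau2\,\mathbb E\Big[\mathrm{Tr}\big(g(\Theta u_n)\mathbf Q^{\frac12}(g(\Theta u_n)\mathbf Q^{\frac12})^*\big)\Big],$$ as an identity in $[0,\infty]$, where $\mathrm{Tr}(g(\Theta u)\mathbf Q^{\frac12}(g(\Theta u)\mathbf Q^{\frac12})^*)=\sum_i\|g(\Theta u)\mathbf Q^{\frac12}e_i\|_{L^2}^2$. If $\mathbb E\|u_0\|_{\dot{\mathbb H}^1}^p<\infty$ and $\mathbb E\|v_0\|_{L^2}^p<\infty$ for every $p\in\mathbb N$ (for instance, if $X_0$ is deterministic), then $\mathbb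 E[V(u_n,v_n,q_n)]$ and $\mathbb E[\mathrm{Tr}(g(\Theta u_n)\mathbf Q^{\frac12}(g(\Theta u_n)\mathbf Q^{\frac12})^*)]$ are finite for every $0\le n\le N$, and the law is an identity between real numbers. -/

import Mathlib

open MeasureTheory ProbabilityTheory Filter Topology
open scoped NNReal ENNReal

noncomputable section

namespace StochWave

/-! ### The spatial domain, weak derivatives and the Dirichlet Laplacian -/

/-- A nonempty bounded open convex domain whose boundary is polygonal (polyhedral): its closure is
the convex hull of finitely many points. -/
structure IsConvexPolytopeDomain {d : ℕ} (O : Set (EuclideanSpace ℝ (Fin d))) : Prop where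
  isOpen : IsOpen O
  nonempty : O.Nonempty
  convex : Convex ℝ O
  polytope : ∃ s : Finset (EuclideanSpace ℝ (Fin d)),
    closure O = convexHull ℝ (s : Set (EuclideanSpace ℝ (Fin d)))

/-- The space `L²(O; ℝ)`. -/
abbrev L2 {d : ℕ} (O : Set (EuclideanSpace ℝ (Fin d))) : Type :=
  Lp ℝ 2 (volume.restrict O)

/-- Test functions: smooth functions with compact support contained in `O`. -/
structure IsTest {d : ℕ} (O : Set (EuclideanSpace ℝ (Fin d)))
    (φ : EuclideanSpace ℝ (Fin d) → ℝ) : Prop where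
  smooth : ContDiff ℝ (⊤ : ℕ∞) φ
  compact : HasCompactSupport φ
  subset : tsupport φ ⊆ O

/-- Classical partial derivative in the direction of the `j`-th coordinate. -/
def pderiv {d : ℕ} (j : Fin d) (φ : EuclideanSpace ℝ (Fin d) → ℝ)
    (x : EuclideanSpace ℝ (Fin d)) : ℝ :=
  fderiv ℝ φ x (EuclideanSpace.single j 1)

/-- `w ∈ L²(O)` is the weak partial derivative `∂u/∂x_j` of `u ∈ L²(O)`. -/
def HasWeakDeriv {d : ℕ} {O : Set (EuclideanSpace ℝ (Fin d))} (j : Fin d) (u w : L2 O) : Prop :=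
  ∀ φ, IsTest O φ → ∫ x in O, u x * pderiv j φ x = - ∫ x in O, w x * φ x

open Classical in
/-- The weak partial derivative in `L²(O)`, where it exists (it is then unique); `0` otherwise. -/
def weakDeriv {d : ℕ} {O : Set (EuclideanSpace ℝ (Fin d))} (j : Fin d) (u : L2 O) : L2 O :=
  if h : ∃ w, HasWeakDeriv j u w then h.choose else 0

/-- Membership in the Sobolev space `H¹₀(O)`: `u` has weak partial derivatives in `L²(O)` and is a
limit of test functions in the norm of `H¹(O)`. -/
def MemH10 {d : ℕ} {O : Set (EuclideanSpace ℝ (Fin d))} (u : L2 O) : Prop :=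
  (∀ j, HasWeakDeriv j u (weakDeriv j u)) ∧
  ∀ ε : ℝ≥0∞, 0 < ε → ∃ φ, IsTest O φ ∧
    eLpNorm (fun x => u x - φ x) 2 (volume.restrict O) ≤ ε ∧
    ∀ j, eLpNorm (fun x => weakDeriv j u x - pderiv j φ x) 2 (volume.restrict O) ≤ ε

/-- A complete system of eigenpairs `(lam i, basis i)` of `-Λ`, where `Λ` is the Laplace operator
on `O` with homogeneous Dirichlet boundary condition: the `basis i` form an orthonormal basis of
`L²(O)`, lie in `H¹₀(O)`, and satisfy `-Λ (basis i) = lam i • basis i` in the weak sense.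
(The numbering starts at `0`.) -/
structure DirichletEigenpairs {d : ℕ} (O : Set (EuclideanSpace ℝ (Fin d))) where
  lam : ℕ → ℝ
  basis : HilbertBasis ℕ ℝ (L2 O)
  lam_pos : ∀ i, 0 < lam i
  lam_mono : Monotone lam
  memH10 : ∀ i, MemH10 (basis i)
  eigen : ∀ i φ, IsTest O φ →
    ∑ j, ∫ x in O, weakDeriv j (basis i) x * pderiv j φ x
      = lam i * ∫ x in O, basis i x * φ x

section Spectral

variable {d : ℕ} {O : Set (EuclideanSpace ℝ (Fin d))} (E : DirichletEigenpairs O)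

/-- The `i`-th coefficient `⟨x, e_i⟩` in `L²`. -/
def DirichletEigenpairs.coef (i : ℕ) (x : L2 O) : ℝ := inner ℝ (E.basis i) x

/-- The space `Ḣ¹ = D((-Λ)^{1/2})` of all `x ∈ L²` with `∑ λ_i ⟨x, e_i⟩² < ∞`. -/
def DirichletEigenpairs.Hdot1 : Submodule ℝ (L2 O) where
  carrier := {x | Summable fun i => E.lam i * E.coef i x ^ 2}
  zero_mem' := by simp [DirichletEigenpairs.coef, summable_zero]
  add_mem' := by
    intro a b ha hb
    refine Summable.of_nonneg_of_le (fun i => mul_nonneg (E.lam_pos i).le (sq_nonneg _))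
      (fun i => ?_) ((ha.mul_left 2).add (hb.mul_left 2))
    have h := (E.lam_pos i).le
    have h2 : E.coef i (a + b) = E.coef i a + E.coef i b := by
      simp [DirichletEigenpairs.coef, inner_add_right]
    rw [h2]
    nlinarith [mul_nonneg h (sq_nonneg (E.coef i a - E.coef i b))]
  smul_mem' := by
    intro c a ha
    have h : (fun i => E.lam i * E.coef i (c • a) ^ 2)
        = fun i => c ^ 2 * (E.lam i * E.coef i a ^ 2) := by
      funext i
      simp only [DirichletEigenpairs.coef, inner_smul_right]
      ring
    show Summable fun i => E.lam i * E.coef i (c • a) ^ 2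
    rw [h]
    exact ha.mul_left _

/-- The inner product `⟨x, y⟩_{Ḣ¹} = ∑ λ_i ⟨x, e_i⟩ ⟨y, e_i⟩`. -/
def DirichletEigenpairs.hInner (x y : E.Hdot1) : ℝ :=
  ∑' i, E.lam i * E.coef i (x : L2 O) * E.coef i (y : L2 O)

/-- The norm of `Ḣ¹`. -/
def DirichletEigenpairs.hNorm (x : E.Hdot1) : ℝ := √(E.hInner x x)

/-- The operator `m(-Λ)`, `x ↦ ∑ m(λ_i) ⟨x, e_i⟩ e_i`, for `x` in its domain, that is if
`∑ m(λ_i)² ⟨x, e_i⟩² < ∞`. -/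
def DirichletEigenpairs.spec (m : ℝ → ℝ) (x : L2 O) : L2 O :=
  ∑' i, (m (E.lam i) * E.coef i x) • E.basis i

/-- The group `E(t) = exp(tA)`, `A = [[0, I], [Λ, 0]]`, on `Ḣ¹ × L²`:
`E(t) = [[C(t), (-Λ)^{-1/2} S(t)], [-(-Λ)^{1/2} S(t), C(t)]]` with `C(t) = cos(t (-Λ)^{1/2})` and
`S(t) = sin(t (-Λ)^{1/2})`. -/
def DirichletEigenpairs.group (t : ℝ) (X : E.Hdot1 × L2 O) : L2 O × L2 O :=
  (E.spec (fun l => Real.cos (t * √l)) (X.1 : L2 O)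
      + E.spec (fun l => (√l)⁻¹ * Real.sin (t * √l)) X.2,
    - E.spec (fun l => √l * Real.sin (t * √l)) (X.1 : L2 O)
      + E.spec (fun l => Real.cos (t * √l)) X.2)

/-- The inverse `A⁻¹ (x, y) = (Λ⁻¹ y, x)` of `A = [[0, I], [Λ, 0]]`. -/
def DirichletEigenpairs.invA (X : L2 O × L2 O) : L2 O × L2 O :=
  (- E.spec (fun l => l⁻¹) X.2, X.1)

/-- `Θ u = (u, ∂u/∂x_1, …, ∂u/∂x_d)`. -/
def DirichletEigenpairs.theta (u : E.Hdot1) : E.Hdot1 × (Fin d → L2 O) :=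
  (u, fun j => weakDeriv j (u : L2 O))

/-- A symmetric, positive definite operator `Q` of finite trace on `L²(O)`, with its
positive square root `root`. -/
structure Covariance where
  Q : L2 O →L[ℝ] L2 O
  root : L2 O →L[ℝ] L2 O
  symm : ∀ x y, inner ℝ (Q x) y = inner ℝ x (Q y)
  posDef : ∀ x, x ≠ 0 → 0 < inner ℝ (Q x) x
  finiteTrace : Summable fun k => inner ℝ (Q (E.basis k)) (E.basis k)
  root_pos : root.IsPositive
  root_sq : root ∘L root = Q

variable {E} (R : Covariance E)

/-- The point `Q^{1/2} x` of the space `Q^{1/2}(L²)`. -/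
def Covariance.rootMk (x : L2 O) : LinearMap.range R.root.toLinearMap :=
  ⟨R.root x, LinearMap.mem_range_self _ x⟩

/-- The space of Hilbert--Schmidt operators from the Hilbert space `Q^{1/2}(L²)`, which carries the
norm `‖Q^{1/2} x‖ = ‖x‖_{L²}` and has the orthonormal basis `(Q^{1/2} e_k)_k`, to `L²`:
the linear maps `T` that are bounded and satisfy `∑ ‖T Q^{1/2} e_k‖² < ∞`. -/
def Covariance.HS : Submodule ℝ (LinearMap.range R.root.toLinearMap →ₗ[ℝ] L2 O) where
  carrier := {T | Continuous (fun x : L2 O => T (R.rootMk x)) ∧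
    Summable fun k => ‖T (R.rootMk (E.basis k))‖ ^ 2}
  zero_mem' := by simp [continuous_const, summable_zero]
  add_mem' := by
    rintro a b ⟨ha, ha'⟩ ⟨hb, hb'⟩
    refine ⟨ha.add hb, ?_⟩
    refine Summable.of_nonneg_of_le (fun i => sq_nonneg _) (fun i => ?_)
      ((ha'.mul_left 2).add (hb'.mul_left 2))
    have h := norm_add_le (a (R.rootMk (E.basis i))) (b (R.rootMk (E.basis i)))
    rw [LinearMap.add_apply]
    nlinarith [norm_nonneg (a (R.rootMk (E.basis i)) + b (R.rootMk (E.basis i))),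
      sq_nonneg (‖a (R.rootMk (E.basis i))‖ - ‖b (R.rootMk (E.basis i))‖)]
  smul_mem' := by
    rintro c a ⟨ha, ha'⟩
    refine ⟨ha.const_smul c, ?_⟩
    have h : (fun k => ‖(c • a) (R.rootMk (E.basis k))‖ ^ 2)
        = fun k => ‖c‖ ^ 2 * ‖a (R.rootMk (E.basis k))‖ ^ 2 := by
      funext k
      rw [LinearMap.smul_apply, norm_smul, mul_pow]
    rw [h]
    exact ha'.mul_left _

/-- `Tr (T Q^{1/2} (T Q^{1/2})^*) = ∑ ⟨T Q^{1/2} e_k, T Q^{1/2} e_k⟩`. -/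
def Covariance.trace (T : R.HS) : ℝ :=
  ∑' k, inner ℝ (T.1 (R.rootMk (E.basis k))) (T.1 (R.rootMk (E.basis k)))

/-- The Hilbert--Schmidt norm on `L₂(Q^{1/2}(L²), L²)`. -/
def Covariance.hsNorm (T : R.HS) : ℝ := √(R.trace T)

/-- The potential `F(u) = ∫_O F̃(u(x)) dx`. -/
def potential (Ft : ℝ → ℝ) (u : E.Hdot1) : ℝ := ∫ x in O, Ft ((u : L2 O) x)

/-- The standing assumption on `f`, `g` and the potential: polynomial growth and polynomially local
Lipschitz continuity of `f : Ḣ¹ → L²` and of `g` along `Θ u`, and `f(u) = F̃'(u)` with a potential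
that is finite on `Ḣ¹` and coercive. (Coercivity includes that the `L^{2k+2}` norm in it
is finite on `Ḣ¹`.) -/
structure Coefficients (Ft : ℝ → ℝ) (f : E.Hdot1 → L2 O)
    (g : E.Hdot1 × (Fin d → L2 O) → R.HS) (k : ℕ) (δ : ℝ) : Prop where
  k_pos : 1 ≤ k
  δ_pos : 0 < δ
  f_growth : ∃ b₁ : Polynomial ℝ, b₁.natDegree ≤ 2 * k + 1 ∧
    ∀ u, ‖f u‖ ≤ b₁.eval (E.hNorm u)
  f_lipschitz : ∃ b₂ : MvPolynomial (Fin 2) ℝ, b₂.totalDegree ≤ 2 * k ∧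
    ∀ u w, ‖f u - f w‖ ≤ MvPolynomial.eval ![E.hNorm u, E.hNorm w] b₂ * E.hNorm (u - w)
  g_growth : ∃ c₂ : ℝ, 0 ≤ c₂ ∧ ∀ u, R.hsNorm (g (E.theta u)) ≤
    c₂ * (1 + (eLpNorm (u : L2 O) (2 * k + 2) (volume.restrict O)).toReal ^ (k + 1) + E.hNorm u)
  g_lipschitz : ∃ b₃ : MvPolynomial (Fin 2) ℝ, b₃.totalDegree ≤ k ∧
    ∀ u w, R.hsNorm (g (E.theta u) - g (E.theta w)) ≤
      MvPolynomial.eval ![E.hNorm u, E.hNorm w] b₃ * E.hNorm (u - w)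
  differentiable : Differentiable ℝ Ft
  f_eq : ∀ u, (f u : EuclideanSpace ℝ (Fin d) → ℝ)
    =ᵐ[volume.restrict O] fun x => deriv Ft ((u : L2 O) x)
  integrable : ∀ u : E.Hdot1, IntegrableOn (fun x => Ft ((u : L2 O) x)) O
  coercive : ∃ c₃ c₄ : ℝ, 0 < c₃ ∧ 0 < c₄ ∧ ∀ u : E.Hdot1,
    MemLp (u : L2 O) (2 * k + 2) (volume.restrict O) ∧
    c₃ * ‖(u : L2 O)‖ ^ 2
      + c₄ * (eLpNorm (u : L2 O) (2 * k + 2) (volume.restrict O)).toReal ^ (2 * k + 2)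
      ≤ potential Ft u + δ

end Spectral

/-! ### The driving noise -/

/-- `(β k)_k` is a sequence of independent real Brownian motions relative to the
filtration `ℱ`: each is a Brownian motion, the family is independent, and the joint
process is adapted to `ℱ` with increments after time `s` independent of `ℱ s`. -/
structure IsBrownianSequence {Ω : Type*} {mΩ : MeasurableSpace Ω} (P : Measure Ω)
    (ℱ : Filtration ℝ≥0 mΩ) (β : ℕ → ℝ≥0 → Ω → ℝ) : Prop where
  brownian : ∀ k, IsBrownianReal (β k) P
  indep : iIndepFun (fun k ω t => β k t ω) P
  adapted : ∀ k t, Measurable[ℱ t] (β k t)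
  indep_past : ∀ s t : ℝ≥0, s ≤ t →
    Indep (MeasurableSpace.comap (fun ω k => β k t ω - β k s ω) MeasurableSpace.pi) (ℱ s) P

section Schemes

variable {d : ℕ} {O : Set (EuclideanSpace ℝ (Fin d))} {E : DirichletEigenpairs O}
  (R : Covariance E)

/-- `G` is (a version of) `T δW`, where `T` is a random Hilbert--Schmidt operator and
`δW = W(t) - W(s)` for `W = ∑ Q^{1/2} e_k β_k`: the sum `∑ (β_k(t) - β_k(s)) T Q^{1/2} e_k`, as a
limit in probability in `L²(O)`. -/
def IsNoiseTerm {Ω : Type*} {mΩ : MeasurableSpace Ω} (P : Measure Ω)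
    (β : ℕ → ℝ≥0 → Ω → ℝ) (s t : ℝ≥0) (T : Ω → R.HS) (G : Ω → L2 O) : Prop :=
  TendstoInMeasure P
    (fun (K : ℕ) ω => ∑ k ∈ Finset.range K,
      (β k t ω - β k s ω) • (T ω).1 (R.rootMk (E.basis k)))
    atTop G

/-- The two choices for the explicit argument `û_n` of the nonlinearity. -/
inductive Extrapolation
  | current
  | linear

/-- `û_n = u_n`, respectively `û_n = (3 u_n - u_{n-1}) / 2` with `u_{-1} = u_0` (which is the
effect of the truncated subtraction `0 - 1 = 0`). -/
def Extrapolation.hat (χ : Extrapolation) (u : ℕ → E.Hdot1) (n : ℕ) : E.Hdot1 :=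
  match χ with
  | .current => u n
  | .linear => (1 / 2 : ℝ) • ((3 : ℝ) • u n - u (n - 1))

/-- `f(û) / √(F(û) + δ) * (q + q') / 2`. -/
def savForce (Ft : ℝ → ℝ) (f : E.Hdot1 → L2 O) (δ : ℝ) (w : E.Hdot1) (q q' : ℝ) : L2 O :=
  ((q + q') / 2 / √(potential Ft w + δ)) • f w

/-- The update `q' = q + ⟨f(û), u' - u⟩ / (2 √(F(û) + δ))` of the auxiliary variable. -/
def AuxStep (Ft : ℝ → ℝ) (f : E.Hdot1 → L2 O) (δ : ℝ) (w u u' : E.Hdot1) (q q' : ℝ) : Prop :=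
  q' = q + inner ℝ (f w) ((u' - u : E.Hdot1) : L2 O) / (2 * √(potential Ft w + δ))

/-- One step of the midpoint SAV scheme with time step `τ` and noise term `G`. The equation for `v'`
contains `Λ (u + u')` and is an equation in `Ḣ^{-1}`, the dual of `Ḣ¹`; it is tested with all
`w ∈ Ḣ¹`, where `⟨Λ x, w⟩ = -⟨x, w⟩_{Ḣ¹}`. -/
def MidpointStep (Ft : ℝ → ℝ) (f : E.Hdot1 → L2 O) (δ τ : ℝ) (hat : E.Hdot1) (G : L2 O)
    (u u' : E.Hdot1) (v v' : L2 O) (q q' : ℝ) : Prop :=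
  (u' : L2 O) = (u : L2 O) + (τ / 2) • (v + v') + (τ / 2) • G ∧
  (∀ w : E.Hdot1, inner ℝ v' (w : L2 O) = inner ℝ v (w : L2 O) - τ / 2 * E.hInner (u + u') w
      - τ * inner ℝ (savForce Ft f δ hat q q') (w : L2 O) + inner ℝ G (w : L2 O)) ∧
  AuxStep Ft f δ hat u u' q q'

/-- One step of the exponential Euler SAV scheme with time step `τ` and noise term `G`:
`X' = E(τ) X + A⁻¹ (E(τ) - I) (0, -b) + E(τ) (0, G)`, `b` the force `savForce`. -/
def ExponentialStep (Ft : ℝ → ℝ) (f : E.Hdot1 → L2 O) (δ τ : ℝ) (hat : E.Hdot1) (G : L2 O)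
    (u u' : E.Hdot1) (v v' : L2 O) (q q' : ℝ) : Prop :=
  ((u' : L2 O), v') = E.group τ (u, v)
      + E.invA (E.group τ (0, - savForce Ft f δ hat q q') - (0, - savForce Ft f δ hat q q'))
      + E.group τ (0, G) ∧
  AuxStep Ft f δ hat u u' q q'

/-- The two SAV schemes. -/
inductive Scheme
  | midpoint
  | exponential

/-- One step of the given scheme. -/
def Scheme.Step (σ : Scheme) (Ft : ℝ → ℝ) (f : E.Hdot1 → L2 O) (δ τ : ℝ) (hat : E.Hdot1)
    (G : L2 O) (u u' : E.Hdot1) (v v' : L2 O) (q q' : ℝ) : Prop :=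
  match σ with
  | .midpoint => MidpointStep Ft f δ τ hat G u u' v v' q q'
  | .exponential => ExponentialStep Ft f δ τ hat G u u' v v' q q'

/-- `(u n, v n, q n)`, `n = 0, …, N`, is a numerical solution of the scheme `σ` with step size `τ`
started at `(u₀, v₀)` with `q₀ = √(F(u₀) + δ)`. All equations hold almost surely. -/
structure IsSAVSolution (σ : Scheme) (χ : Extrapolation) (Ft : ℝ → ℝ) (f : E.Hdot1 → L2 O)
    (g : E.Hdot1 × (Fin d → L2 O) → R.HS) (δ : ℝ) {Ω : Type*} {mΩ : MeasurableSpace Ω}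
    (P : Measure Ω) (β : ℕ → ℝ≥0 → Ω → ℝ) (N : ℕ) (τ : ℝ≥0) (u₀ : Ω → E.Hdot1) (v₀ : Ω → L2 O)
    (u : ℕ → Ω → E.Hdot1) (v : ℕ → Ω → L2 O) (q : ℕ → Ω → ℝ) : Prop where
  init : ∀ᵐ ω ∂P, u 0 ω = u₀ ω ∧ v 0 ω = v₀ ω ∧ q 0 ω = √(potential Ft (u₀ ω) + δ)
  step : ∀ n < N, ∃ G : Ω → L2 O,
    IsNoiseTerm R P β (n * τ) ((n + 1) * τ) (fun ω => g (E.theta (u n ω))) G ∧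
    ∀ᵐ ω ∂P, σ.Step Ft f δ τ (χ.hat (fun m => u m ω) n) (G ω)
      (u n ω) (u (n + 1) ω) (v n ω) (v (n + 1) ω) (q n ω) (q (n + 1) ω)

end Schemes

/-- The modified energy `V(u, v, q) = ½ ‖u‖²_{Ḣ¹} + ½ ‖v‖²_{L²} + q²`. -/
def modEnergy {d : ℕ} {O : Set (EuclideanSpace ℝ (Fin d))} (E : DirichletEigenpairs O)
    (u : E.Hdot1) (v : L2 O) (q : ℝ) : ℝ :=
  1 / 2 * E.hNorm u ^ 2 + 1 / 2 * ‖v‖ ^ 2 + q ^ 2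

end StochWave

end

open StochWave

/-! The law rests on an exact pathwise balance, followed by an Itô-type identity for a single
increment.

Both schemes see the noise `G` only through the replacement of `v` by `v + G`. In each eigenmode
what remains is one step for the oscillator `u̇ = v`, `v̇ = -λ u - b` with `b` held fixed: the
implicit midpoint rule in one scheme, the exact flow in the other. Both conserve the quadratic
quantity `λ u² + v² + 2 b u` (`exists_coefStep`). After summation over the modes, the update of `q`
turns `2 ⟨b, u' - u⟩` into `2 (q'² - q²)`, so that `V(u', v', q') = V(u, v + G, q)` almost surely
(`modEnergy_step`).

It remains to show `E‖v + G‖² = E‖v‖² + τ E Tr`. Given the past, `G` is a Gaussian series with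
frozen coefficients, whose second moment follows from Parseval and scalar Gaussian moments
(`lintegral_enorm_add_noise_sq`).

Freezing requires that `v n` and the coefficients `g(Θ u n) Q^{1/2} e_i` be measurable with respect
to the past. The schemes are implicit and a solution is merely a family of maps satisfying the
equations, so adaptedness has to be proved. The new `q'` solves a scalar linear equation with
nonzero leading coefficient, and then `u'`, `v'` are explicit mode by mode
(`aestronglyMeasurable_step`). The maps `f`, `g` and the potential are continuous for the norm of
`Ḣ¹` only; spectral truncation makes them measurable functions of `L²`-valued data.

Finiteness is an induction on moments of all orders: the trace is bounded by a polynomial in the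
`Ḣ¹` norm, the moments of `G` by those of the trace, and `V(u', v', q') ≤ 2 V(u, v, q) + ‖G‖²`. A
single fixed order would not close the induction. -/

noncomputable section

namespace StochWave

/-! ### Freezing one of two independent variables -/

section Freezing

variable {Ω α β : Type*} {mΩ : MeasurableSpace Ω} {mα : MeasurableSpace α}
  {mβ : MeasurableSpace β} {P : Measure Ω} [IsFiniteMeasure P] {X : Ω → α} {Y : Ω → β}

/-- Under independence the joint law is a product, so this is Tonelli. It replaces conditioning on
the past: the variable `X` is frozen while `Y` is averaged. -/
theorem lintegral_comp_prodMk_of_indepFun (hX : Measurable X) (hY : Measurable Y)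
    (h : IndepFun X Y P) {Φ : α × β → ℝ≥0∞} (hΦ : Measurable Φ) :
    ∫⁻ ω, Φ (X ω, Y ω) ∂P = ∫⁻ ω, ∫⁻ ω', Φ (X ω, Y ω') ∂P ∂P := by
  have h1 := h.map_prod_eq_prod_map_map hX.aemeasurable hY.aemeasurable
  rw [← lintegral_map (f := Φ) hΦ (hX.prodMk hY), h1, lintegral_prod _ hΦ.aemeasurable,
    lintegral_map (f := fun x => ∫⁻ y, Φ (x, y) ∂P.map Y) hΦ.lintegral_prod_right' hX]
  refine lintegral_congr fun ω => ?_
  exact lintegral_map (f := fun y => Φ (X ω, y)) (hΦ.comp measurable_prodMk_left) hY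

/-- Used to pass almost sure convergence of a random series to almost every choice of frozen
coefficients. -/
theorem ae_ae_of_indepFun (hX : Measurable X) (hY : Measurable Y)
    (h : IndepFun X Y P) {s : Set (α × β)} (hs : MeasurableSet s)
    (hae : ∀ᵐ ω ∂P, (X ω, Y ω) ∈ s) : ∀ᵐ ω ∂P, ∀ᵐ ω' ∂P, (X ω, Y ω') ∈ s := by
  have h0 : ∫⁻ ω, sᶜ.indicator (fun _ => (1 : ℝ≥0∞)) (X ω, Y ω) ∂P = 0 := by
    rw [← lintegral_zero (μ := P)]
    refine lintegral_congr_ae ?_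
    filter_upwards [hae] with ω hω
    simp [hω]
  have hm : Measurable (sᶜ.indicator fun _ => (1 : ℝ≥0∞)) := measurable_const.indicator hs.compl
  rw [lintegral_comp_prodMk_of_indepFun hX hY h hm] at h0
  have hmeas : Measurable fun ω => ∫⁻ ω', sᶜ.indicator (fun _ => (1 : ℝ≥0∞)) (X ω, Y ω') ∂P :=
    (Measurable.lintegral_prod_right' (f := fun z : α × Ω =>
      sᶜ.indicator (fun _ => (1 : ℝ≥0∞)) (z.1, Y z.2))
      (hm.comp (measurable_fst.prodMk (hY.comp measurable_snd)))).comp hX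
  rw [lintegral_eq_zero_iff hmeas] at h0
  filter_upwards [h0] with ω hω
  have h2 : Measurable fun ω' => sᶜ.indicator (fun _ => (1 : ℝ≥0∞)) (X ω, Y ω') :=
    hm.comp (measurable_const.prodMk hY)
  have h3 := (lintegral_eq_zero_iff h2).1 hω
  filter_upwards [h3] with ω' hω'
  by_contra hc
  simp [hc] at hω'

end Freezing

theorem enorm_sq_eq_ofReal_sq (y : ℝ) : ‖y‖ₑ ^ 2 = ENNReal.ofReal (y ^ 2) := by
  rw [← ofReal_norm, ← ENNReal.ofReal_pow (norm_nonneg _), Real.norm_eq_abs, sq_abs]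

theorem enorm_sq_eq_ofReal_norm_sq {E : Type*} [SeminormedAddGroup E] (y : E) :
    ‖y‖ₑ ^ 2 = ENNReal.ofReal (‖y‖ ^ 2) := by
  rw [← ofReal_norm, ← ENNReal.ofReal_pow (norm_nonneg _)]

/-! ### Scalar Gaussian sums and their moments -/

section GaussianSums

variable {Ω : Type*} {mΩ : MeasurableSpace Ω} {P : Measure Ω}
  {ξ : ℕ → Ω → ℝ} {V : ℝ≥0}

theorem hasLaw_sum_gaussian [IsProbabilityMeasure P] (hm : ∀ k, Measurable (ξ k))
    (hξ : iIndepFun ξ P)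
    (hlaw : ∀ k, HasLaw (ξ k) (gaussianReal 0 V) P) (c : ℕ → ℝ) (I : Finset ℕ) :
    HasLaw (fun ω => ∑ k ∈ I, ξ k ω * c k)
      (gaussianReal 0 (V * (∑ k ∈ I, c k ^ 2).toNNReal)) P := by
  classical
  induction I using Finset.induction_on with
  | empty =>
    refine ⟨by fun_prop, ?_⟩
    simp [Measure.map_const]
  | insert i I hi ih =>
    have hm' : ∀ k, Measurable fun ω => ξ k ω * c k := fun k => (hm k).mul_const _
    have hind : iIndepFun (fun k ω => ξ k ω * c k) P :=
      hξ.comp (fun k x => x * c k) fun k => by fun_prop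
    have h1 := hind.indepFun_finsetSum_of_notMem hm' hi
    have h2 : P.map (fun ω => ξ i ω * c i) = gaussianReal 0 (V * (c i ^ 2).toNNReal) := by
      have := gaussianReal_mul_const (hlaw i) (c i)
      rw [this.map_eq]
      congr 1
      · simp
      · ext
        simp [Real.coe_toNNReal _ (sq_nonneg (c i)), mul_comm]
    have h3 : P.map (∑ j ∈ I, fun ω => ξ j ω * c j)
        = gaussianReal 0 (V * (∑ k ∈ I, c k ^ 2).toNNReal) := by
      rw [← ih.map_eq]
      congr 1
      ext ω
      simp
    have h4 := gaussianReal_add_gaussianReal_of_indepFun h1 h3 h2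
    refine ⟨by fun_prop, ?_⟩
    rw [show (fun ω => ∑ k ∈ insert i I, ξ k ω * c k)
      = (∑ j ∈ I, fun ω => ξ j ω * c j) + fun ω => ξ i ω * c i by
        ext ω; simp [Finset.sum_insert hi, add_comm], h4, Finset.sum_insert hi]
    congr 1
    · simp
    · rw [Real.toNNReal_add (sq_nonneg _) (Finset.sum_nonneg fun _ _ => sq_nonneg _)]
      ring

theorem lintegral_enorm_add_sq_gaussian {Y : Ω → ℝ} {W : ℝ≥0}
    (hY : HasLaw Y (gaussianReal 0 W) P) (x : ℝ) :
    ∫⁻ ω, ‖x + Y ω‖ₑ ^ 2 ∂P = ‖x‖ₑ ^ 2 + W := by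
  have hL := gaussianReal_const_add hY x
  rw [zero_add] at hL
  rw [hL.lintegral_comp (f := fun y => ‖y‖ₑ ^ 2) (by fun_prop)]
  have hint : Integrable (fun y : ℝ => y ^ 2) (gaussianReal x W) := by
    have := (memLp_id_gaussianReal (μ := x) (v := W) 2).integrable_sq
    simpa using this
  have h1 : ∫ y, y ^ 2 ∂gaussianReal x W = x ^ 2 + W := by
    have := variance_eq_sub (memLp_id_gaussianReal (μ := x) (v := W) 2)
    rw [variance_id_gaussianReal] at this
    simp only [id, integral_id_gaussianReal, Pi.pow_apply] at this
    linarith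
  have h2 := ofReal_integral_eq_lintegral_ofReal hint (ae_of_all _ fun y => sq_nonneg y)
  simp_rw [enorm_sq_eq_ofReal_sq]
  rw [← h2, h1, ENNReal.ofReal_add (sq_nonneg _) W.coe_nonneg, ENNReal.ofReal_coe_nnreal]

/-- The `L^p` norm of the square of a standard Gaussian variable. -/
def gaussianSqNorm (p : ℝ≥0∞) : ℝ≥0∞ := eLpNorm (fun x : ℝ => x ^ 2) p (gaussianReal 0 1)

theorem gaussianSqNorm_lt_top (p : ℕ) : gaussianSqNorm p < ∞ := by
  have h : MemLp (id : ℝ → ℝ) (2 * p : ℝ≥0∞) (gaussianReal 0 1) :=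
    memLp_id_gaussianReal' _ (by finiteness)
  have : ENNReal.HolderTriple (2 * p : ℝ≥0∞) (2 * p) p := by
    constructor
    rcases Nat.eq_zero_or_pos p with rfl | hp
    · simp
    rw [ENNReal.mul_inv (by simp) (by simp), ← add_mul, ENNReal.inv_two_add_inv_two, one_mul]
  have h2 : MemLp (id * id : ℝ → ℝ) (p : ℝ≥0∞) (gaussianReal 0 1) := h.mul h
  have h3 : (fun x : ℝ => x ^ 2) = id * id := by
    ext x
    simp [sq]
  rw [gaussianSqNorm, h3]
  exact h2.2

theorem eLpNorm_sq_gaussian {Y : Ω → ℝ} {W : ℝ≥0} (hY : HasLaw Y (gaussianReal 0 W) P)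
    (p : ℝ≥0∞) : eLpNorm (fun ω => Y ω ^ 2) p P = W * gaussianSqNorm p := by
  have h1 : (gaussianReal 0 1).map (fun x => √(W : ℝ) * x) = gaussianReal 0 W := by
    rw [gaussianReal_map_const_mul]
    congr 1
    · simp
    · ext
      simp
  have h2 : eLpNorm (fun ω => Y ω ^ 2) p P = eLpNorm (fun x : ℝ => x ^ 2) p (gaussianReal 0 W) := by
    rw [← hY.map_eq, eLpNorm_map_measure (by fun_prop) hY.aemeasurable]
    rfl
  rw [h2, ← h1, eLpNorm_map_measure (by fun_prop) (by fun_prop)]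
  have h3 : (fun x : ℝ => x ^ 2) ∘ (fun x => √(W : ℝ) * x) = (W : ℝ) • fun x : ℝ => x ^ 2 := by
    ext x
    simp [mul_pow]
  rw [h3, eLpNorm_const_smul, gaussianSqNorm]
  congr 1
  simp [enorm_eq_nnnorm]

end GaussianSums

/-! ### Gaussian series with deterministic coefficients in a Hilbert space -/

section HilbertSums

variable {H : Type*} [NormedAddCommGroup H] [InnerProductSpace ℝ H]

theorem enorm_sq_eq_tsum_coef (b : HilbertBasis ℕ ℝ H) (x : H) :
    ‖x‖ₑ ^ 2 = ∑' i, ‖inner ℝ (b i) x‖ₑ ^ 2 := by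
  have h := b.hasSum_inner_mul_inner x x
  have h' : (fun i => inner ℝ x (b i) * inner ℝ (b i) x) = fun i => inner ℝ (b i) x ^ 2 := by
    ext i
    rw [real_inner_comm, sq]
  rw [h', real_inner_self_eq_norm_sq] at h
  simp_rw [enorm_sq_eq_ofReal_sq]
  rw [← ENNReal.ofReal_tsum_of_nonneg (fun i => sq_nonneg _) h.summable, h.tsum_eq,
    enorm_sq_eq_ofReal_norm_sq]

variable {Ω : Type*} {mΩ : MeasurableSpace Ω} {P : Measure Ω} [IsProbabilityMeasure P]
  {ξ : ℕ → Ω → ℝ} {V : ℝ≥0}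

/-- Interchanging the two sums and applying Parseval turns the sum of the coordinate variances into
the squared Hilbert–Schmidt norm. -/
theorem tsum_coe_variance (b : HilbertBasis ℕ ℝ H) (a : ℕ → H) (I : Finset ℕ) :
    ∑' i, ((V * (∑ k ∈ I, inner ℝ (b i) (a k) ^ 2).toNNReal : ℝ≥0) : ℝ≥0∞)
      = V * ∑ k ∈ I, ‖a k‖ₑ ^ 2 := by
  have h : ∀ i, ((V * (∑ k ∈ I, inner ℝ (b i) (a k) ^ 2).toNNReal : ℝ≥0) : ℝ≥0∞)
      = V * ∑ k ∈ I, ‖inner ℝ (b i) (a k)‖ₑ ^ 2 := fun i => by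
    rw [ENNReal.coe_mul]
    congr 1
    simp_rw [enorm_sq_eq_ofReal_sq]
    rw [← ENNReal.ofReal_sum_of_nonneg fun _ _ => sq_nonneg _]
    rfl
  simp_rw [h]
  rw [ENNReal.tsum_mul_left, Summable.tsum_finsetSum fun _ _ => ENNReal.summable]
  simp_rw [← enorm_sq_eq_tsum_coef]

theorem inner_basis_sum (b : HilbertBasis ℕ ℝ H) (a : ℕ → H) (I : Finset ℕ) (i : ℕ) (ω : Ω) :
    inner ℝ (b i) (∑ k ∈ I, ξ k ω • a k) = ∑ k ∈ I, ξ k ω * inner ℝ (b i) (a k) := by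
  simp_rw [inner_sum, inner_smul_right]

/-- Computed coordinate by coordinate: each coordinate is a shifted scalar Gaussian, and Tonelli
with Parseval reassembles the norm. -/
theorem lintegral_enorm_add_sum_sq (b : HilbertBasis ℕ ℝ H) (hm : ∀ k, Measurable (ξ k))
    (hξ : iIndepFun ξ P) (hlaw : ∀ k, HasLaw (ξ k) (gaussianReal 0 V) P) (x : H) (a : ℕ → H)
    (I : Finset ℕ) :
    ∫⁻ ω, ‖x + ∑ k ∈ I, ξ k ω • a k‖ₑ ^ 2 ∂P = ‖x‖ₑ ^ 2 + V * ∑ k ∈ I, ‖a k‖ₑ ^ 2 := by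
  simp_rw [enorm_sq_eq_tsum_coef b (x + _), inner_add_right, inner_basis_sum]
  rw [lintegral_tsum fun i => by fun_prop]
  simp_rw [lintegral_enorm_add_sq_gaussian (hasLaw_sum_gaussian hm hξ hlaw _ I)]
  rw [ENNReal.tsum_add, ← enorm_sq_eq_tsum_coef, tsum_coe_variance]

/-- By Parseval the squared norm is a sum of squared scalar Gaussians. Minkowski's inequality in
`L^p` bounds its norm by the total variance times the norm of one standard square; Fatou handles the
infinitely many coordinates. -/
theorem eLpNorm_normSq_sum_le (b : HilbertBasis ℕ ℝ H) (hm : ∀ k, Measurable (ξ k))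
    (hξ : iIndepFun ξ P) (hlaw : ∀ k, HasLaw (ξ k) (gaussianReal 0 V) P) (a : ℕ → H)
    (I : Finset ℕ) {p : ℝ≥0∞} (hp : 1 ≤ p) :
    eLpNorm (fun ω => ‖∑ k ∈ I, ξ k ω • a k‖ ^ 2) p P
      ≤ V * (∑ k ∈ I, ‖a k‖ₑ ^ 2) * gaussianSqNorm p := by
  have hY := fun i => hasLaw_sum_gaussian hm hξ hlaw (fun k => inner ℝ (b i) (a k)) I
  set Y : ℕ → Ω → ℝ := fun i ω => ∑ k ∈ I, ξ k ω * inner ℝ (b i) (a k) with hYdef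
  have hYm : ∀ i, Measurable (Y i) := fun i => by fun_prop
  have hlim : ∀ᵐ ω ∂P, Tendsto (fun n => (∑ i ∈ Finset.range n, fun ω => Y i ω ^ 2) ω) atTop
      (𝓝 (‖∑ k ∈ I, ξ k ω • a k‖ ^ 2)) := by
    refine ae_of_all _ fun ω => ?_
    have h := b.hasSum_inner_mul_inner (∑ k ∈ I, ξ k ω • a k) (∑ k ∈ I, ξ k ω • a k)
    rw [real_inner_self_eq_norm_sq] at h
    refine h.tendsto_sum_nat.congr fun n => ?_
    rw [Finset.sum_apply]
    refine Finset.sum_congr rfl fun i _ => ?_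
    rw [real_inner_comm, ← sq, inner_basis_sum]
  refine (Lp.eLpNorm_lim_le_liminf_eLpNorm (fun n => ?_) _ hlim).trans ?_
  · exact Finset.aestronglyMeasurable_sum _ fun i _ => ((hYm i).pow_const 2).aestronglyMeasurable
  refine liminf_le_of_le (by isBoundedDefault) fun B hB => ?_
  obtain ⟨n, hn⟩ := hB.exists
  refine hn.trans ((eLpNorm_sum_le (fun i _ => ((hYm i).pow_const 2).aestronglyMeasurable)
    hp).trans ?_)
  rw [Finset.sum_congr rfl fun i _ => eLpNorm_sq_gaussian (hY i) p, ← Finset.sum_mul]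
  gcongr
  rw [← tsum_coe_variance b]
  exact ENNReal.sum_le_tsum _

/-- Along a subsequence that converges almost surely, the second moments of the partial sums of a
Gaussian series converge to that of the limit. -/
theorem lintegral_liminf_enorm_add_sum_sq (b : HilbertBasis ℕ ℝ H)
    (hm : ∀ k, Measurable (ξ k)) (hξ : iIndepFun ξ P)
    (hlaw : ∀ k, HasLaw (ξ k) (gaussianReal 0 V) P) (x : H) (a : ℕ → H)
    (ha : ∑' k, ‖a k‖ₑ ^ 2 ≠ ∞) {ns : ℕ → ℕ} (hns : StrictMono ns)
    (hlim : ∀ᵐ ω ∂P, ∃ z, Tendsto (fun j => ∑ k ∈ Finset.range (ns j), ξ k ω • a k) atTop (𝓝 z)) :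
    ∫⁻ ω, liminf (fun j => ‖x + ∑ k ∈ Finset.range (ns j), ξ k ω • a k‖ₑ ^ 2) atTop ∂P
      = ‖x‖ₑ ^ 2 + V * ∑' k, ‖a k‖ₑ ^ 2 := by
  have hSm : ∀ I : Finset ℕ, StronglyMeasurable fun ω => ∑ k ∈ I, ξ k ω • a k := fun I =>
    Finset.stronglyMeasurable_fun_sum I fun k _ =>
      (hm k).stronglyMeasurable.smul stronglyMeasurable_const
  set S : ℕ → Ω → H := fun j ω => ∑ k ∈ Finset.range (ns j), ξ k ω • a k with hS
  have hSjm : ∀ j, AEStronglyMeasurable (S j) P := fun j => (hSm _).aestronglyMeasurable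
  obtain ⟨Z, hZm, hZ⟩ := exists_stronglyMeasurable_limit_of_tendsto_ae hSjm hlim
  have hns' : Tendsto ns atTop atTop := hns.tendsto_atTop
  have hpart : Tendsto (fun j => ∑ k ∈ Finset.range (ns j), ‖a k‖ₑ ^ 2) atTop
      (𝓝 (∑' k, ‖a k‖ₑ ^ 2)) := (ENNReal.tendsto_nat_tsum _).comp hns'
  have hsq : ∀ F : Ω → H, eLpNorm F 2 P ^ 2 = ∫⁻ ω, ‖F ω‖ₑ ^ 2 ∂P := fun F => by
    have := eLpNorm_nnreal_pow_eq_lintegral (f := F) (μ := P) (p := 2) (by norm_num)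
    simpa using this
  -- `tail j` bounds the second moment of every later increment `S l - S j`; by Fatou it also bounds
  -- that of `Z - S j`, which upgrades almost sure convergence to convergence in `L²`.
  set tail : ℕ → ℝ≥0∞ := fun j => V * ∑' k, ‖a (k + ns j)‖ₑ ^ 2 with htail
  have htail0 : Tendsto tail atTop (𝓝 0) := by
    have h1 := (ENNReal.tendsto_sum_nat_add (fun k => ‖a k‖ₑ ^ 2) ha).comp hns'
    have h2 := ENNReal.Tendsto.const_mul (a := (V : ℝ≥0∞)) h1 (Or.inr ENNReal.coe_ne_top)
    simpa using h2
  have hdiff : ∀ j, eLpNorm (S j - Z) 2 P ^ 2 ≤ tail j := fun j => by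
    have h1 : eLpNorm (S j - Z) 2 P ≤ liminf (fun l => eLpNorm (S j - S l) 2 P) atTop := by
      refine Lp.eLpNorm_lim_le_liminf_eLpNorm (fun l => (hSjm j).sub (hSjm l)) _ ?_
      filter_upwards [hZ] with ω hω
      exact tendsto_const_nhds.sub hω
    have h2 : ∀ l, j ≤ l → eLpNorm (S j - S l) 2 P ^ 2 ≤ tail j := fun l hl => by
      have h3 : S j - S l = - fun ω => 0 + ∑ k ∈ Finset.Ico (ns j) (ns l), ξ k ω • a k := by
        ext ω
        simp only [hS, Pi.sub_apply, Pi.neg_apply, zero_add,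
          Finset.sum_Ico_eq_sub _ (hns.monotone hl)]
        abel
      rw [h3, eLpNorm_neg, hsq, lintegral_enorm_add_sum_sq b hm hξ hlaw]
      simp only [enorm_zero, ne_eq, OfNat.ofNat_ne_zero, not_false_eq_true, zero_pow, zero_add,
        htail]
      gcongr
      rw [Finset.sum_Ico_eq_sum_range]
      simp_rw [add_comm (ns j)]
      exact ENNReal.sum_le_tsum _
    -- Any eventual lower bound of the sequence is attained at some index `l ≥ j`, where `h2`
    -- applies.
    have h4 : liminf (fun l => eLpNorm (S j - S l) 2 P) atTop ≤ tail j ^ (1 / 2 : ℝ) := by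
      refine liminf_le_of_le (by isBoundedDefault) fun B hB => ?_
      obtain ⟨l, hl, hl'⟩ := (hB.and (eventually_ge_atTop j)).exists
      refine hl.trans ?_
      rw [one_div, ENNReal.le_rpow_inv_iff (by norm_num)]
      exact_mod_cast h2 l hl'
    calc eLpNorm (S j - Z) 2 P ^ 2 ≤ (tail j ^ (1 / 2 : ℝ)) ^ 2 := by
          gcongr
          exact h1.trans h4
      _ = tail j := by
          rw [← ENNReal.rpow_natCast, ← ENNReal.rpow_mul]
          norm_num
  have hdiff0 : Tendsto (fun j => eLpNorm (S j - Z) 2 P) atTop (𝓝 0) := by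
    have h1 : Tendsto (fun j => eLpNorm (S j - Z) 2 P ^ 2) atTop (𝓝 0) :=
      tendsto_of_tendsto_of_tendsto_of_le_of_le tendsto_const_nhds htail0 (fun _ => zero_le)
        hdiff
    have h2 := (ENNReal.continuous_rpow_const (y := (1 / 2 : ℝ))).continuousAt.tendsto.comp h1
    simp only [ENNReal.zero_rpow_of_pos (by norm_num : (0 : ℝ) < 1 / 2)] at h2
    refine h2.congr fun j => ?_
    simp only [Function.comp]
    rw [← ENNReal.rpow_natCast, ← ENNReal.rpow_mul]
    norm_num
  have hconv : Tendsto (fun j => eLpNorm (fun ω => x + S j ω) 2 P) atTop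
      (𝓝 (eLpNorm (fun ω => x + Z ω) 2 P)) := by
    have hxS : ∀ j, AEStronglyMeasurable (fun ω => x + S j ω) P := fun j =>
      aestronglyMeasurable_const.add (hSjm j)
    have hxZ : AEStronglyMeasurable (fun ω => x + Z ω) P :=
      aestronglyMeasurable_const.add hZm.aestronglyMeasurable
    have hup : ∀ j, eLpNorm (fun ω => x + S j ω) 2 P
        ≤ eLpNorm (fun ω => x + Z ω) 2 P + eLpNorm (S j - Z) 2 P := fun j => by
      have h : (fun ω => x + S j ω) = (fun ω => x + Z ω) + (S j - Z) := by
        ext ω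
        simp [add_assoc]
      rw [h]
      exact eLpNorm_add_le hxZ ((hSjm j).sub hZm.aestronglyMeasurable) (by norm_num)
    have hlo : ∀ j, eLpNorm (fun ω => x + Z ω) 2 P - eLpNorm (S j - Z) 2 P
        ≤ eLpNorm (fun ω => x + S j ω) 2 P := fun j => by
      rw [tsub_le_iff_right]
      have h : (fun ω => x + Z ω) = (fun ω => x + S j ω) - (S j - Z) := by
        ext ω
        simp only [Pi.sub_apply]
        abel
      conv_lhs => rw [h]
      exact eLpNorm_sub_le (hxS j) ((hSjm j).sub hZm.aestronglyMeasurable) (by norm_num)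
    refine tendsto_of_tendsto_of_tendsto_of_le_of_le ?_ ?_ hlo hup
    · have := ENNReal.Tendsto.sub (tendsto_const_nhds (x := eLpNorm (fun ω => x + Z ω) 2 P)) hdiff0
        (Or.inr ENNReal.zero_ne_top)
      simpa using this
    · simpa using (tendsto_const_nhds (x := eLpNorm (fun ω => x + Z ω) 2 P)).add hdiff0
  have hcong : ∫⁻ ω, liminf (fun j => ‖x + S j ω‖ₑ ^ 2) atTop ∂P = ∫⁻ ω, ‖x + Z ω‖ₑ ^ 2 ∂P := by
    refine lintegral_congr_ae ?_
    filter_upwards [hZ] with ω hω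
    exact (ENNReal.Tendsto.pow (tendsto_const_nhds.add hω).enorm).liminf_eq
  have h1 : Tendsto (fun j => ∫⁻ ω, ‖x + S j ω‖ₑ ^ 2 ∂P) atTop (𝓝 (∫⁻ ω, ‖x + Z ω‖ₑ ^ 2 ∂P)) := by
    have := ENNReal.Tendsto.pow (n := 2) hconv
    simpa only [hsq] using this
  have h2 : Tendsto (fun j => ∫⁻ ω, ‖x + S j ω‖ₑ ^ 2 ∂P) atTop
      (𝓝 (‖x‖ₑ ^ 2 + V * ∑' k, ‖a k‖ₑ ^ 2)) := by
    simp_rw [hS, lintegral_enorm_add_sum_sq b hm hξ hlaw]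
    exact tendsto_const_nhds.add (ENNReal.Tendsto.const_mul hpart (Or.inr ENNReal.coe_ne_top))
  rw [hcong]
  exact tendsto_nhds_unique h1 h2

end HilbertSums

/-! ### Measurability of almost sure limits for a sub-σ-algebra -/

theorem aestronglyMeasurable_of_tendsto_ae_sub {Ω F : Type*} {m mΩ : MeasurableSpace Ω}
    [TopologicalSpace F] [TopologicalSpace.IsCompletelyMetrizableSpace F] {P : Measure Ω}
    {f : ℕ → Ω → F} {g : Ω → F} (hf : ∀ i, AEStronglyMeasurable[m] (f i) P)
    (lim : ∀ᵐ ω ∂P, Tendsto (fun n => f n ω) atTop (𝓝 (g ω))) :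
    AEStronglyMeasurable[m] g P := by
  rcases isEmpty_or_nonempty Ω with hΩ | ⟨⟨ω₀⟩⟩
  · exact Subsingleton.elim (f 0) g ▸ hf 0
  have : Nonempty F := ⟨g ω₀⟩
  choose f' hf' hff' using hf
  -- The null set where convergence fails need not belong to `m`. `limUnder` of the `m`-measurable
  -- versions is `m`-measurable on all of `Ω` and agrees with `g` wherever they converge to it.
  refine ⟨fun ω => limUnder atTop fun n => f' n ω, @StronglyMeasurable.limUnder _ _ _ m _ _ _ _ _ _ _ hf', ?_⟩
  filter_upwards [lim, ae_all_iff.2 hff'] with ω hω hω'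
  rw [Tendsto.limUnder_eq]
  exact hω.congr hω'

theorem eLpNorm_natCast_pow_eq_lintegral {Ω F : Type*} {mΩ : MeasurableSpace Ω}
    [NormedAddCommGroup F] {P : Measure Ω} {f : Ω → F} {p : ℕ} (hp : 1 ≤ p) :
    eLpNorm f p P ^ p = ∫⁻ ω, ‖f ω‖ₑ ^ p ∂P := by
  have h := eLpNorm_nnreal_pow_eq_lintegral (f := f) (μ := P) (p := (p : ℝ≥0))
    (by exact_mod_cast (by lia : p ≠ 0))
  simpa using h

theorem aestronglyMeasurable_noise {H Ω : Type*} [NormedAddCommGroup H] [NormedSpace ℝ H]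
    [CompleteSpace H] {m mΩ : MeasurableSpace Ω} {P : Measure Ω} {ξ : ℕ → Ω → ℝ} {a : ℕ → Ω → H}
    {G : Ω → H} (hm : ∀ k, Measurable[m] (ξ k))
    (ha : ∀ k, AEStronglyMeasurable[m] (a k) P)
    (hG : TendstoInMeasure P (fun (K : ℕ) ω => ∑ k ∈ Finset.range K, ξ k ω • a k ω) atTop G) :
    AEStronglyMeasurable[m] G P := by
  obtain ⟨ns, -, hlim⟩ := hG.exists_seq_tendsto_ae
  refine aestronglyMeasurable_of_tendsto_ae_sub (fun j => ?_) hlim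
  choose a' ha' haa' using ha
  refine ⟨fun ω => ∑ k ∈ Finset.range (ns j), ξ k ω • a' k ω,
    Finset.stronglyMeasurable_fun_sum _ fun k _ => (hm k).stronglyMeasurable.smul (ha' k), ?_⟩
  filter_upwards [ae_all_iff.2 haa'] with ω hω
  simp only [hω]

/-! ### The noise term with random coefficients from the past -/

section Noise

variable {H : Type*} [NormedAddCommGroup H] [InnerProductSpace ℝ H]
  [SecondCountableTopology H] {Ω : Type*} {m mΩ : MeasurableSpace Ω} {P : Measure Ω}
  [IsProbabilityMeasure P] {ξ : ℕ → Ω → ℝ} {V : ℝ≥0} {a : ℕ → Ω → H} {v G : Ω → H}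

/-- The cross term vanishes and the noise contributes its variance because, once `v` and `a` are
frozen, the increments `ξ` are still independent centred Gaussians. -/
theorem lintegral_enorm_add_noise_sq [CompleteSpace H] (b : HilbertBasis ℕ ℝ H) (hmle : m ≤ mΩ)
    (hm : ∀ k, Measurable (ξ k)) (hξ : iIndepFun ξ P)
    (hlaw : ∀ k, HasLaw (ξ k) (gaussianReal 0 V) P)
    (hpast : Indep (MeasurableSpace.comap (fun ω k => ξ k ω) MeasurableSpace.pi) m P)
    (hv : AEStronglyMeasurable[m] v P) (ha : ∀ k, AEStronglyMeasurable[m] (a k) P)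
    (hfin : ∀ᵐ ω ∂P, ∑' k, ‖a k ω‖ₑ ^ 2 ≠ ∞)
    (hG : TendstoInMeasure P (fun (K : ℕ) ω => ∑ k ∈ Finset.range K, ξ k ω • a k ω) atTop G) :
    ∫⁻ ω, ‖v ω + G ω‖ₑ ^ 2 ∂P
      = ∫⁻ ω, ‖v ω‖ₑ ^ 2 ∂P + V * ∫⁻ ω, ∑' k, ‖a k ω‖ₑ ^ 2 ∂P := by
  borelize H
  obtain ⟨ns, hns, hlim⟩ := hG.exists_seq_tendsto_ae
  obtain ⟨v', hv', hvv'⟩ := hv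
  choose a' ha' haa' using ha
  have haa : ∀ᵐ ω ∂P, ∀ k, a k ω = a' k ω := ae_all_iff.2 haa'
  set X : Ω → H × (ℕ → H) := fun ω => (v' ω, fun k => a' k ω) with hX
  set Y : Ω → ℕ → ℝ := fun ω k => ξ k ω with hY
  have hXm : Measurable[m] X :=
    @Measurable.prodMk _ m _ _ _ _ _ _ hv'.measurable
      (@measurable_pi_lambda _ _ _ m _ _ fun k => (ha' k).measurable)
  have hXm' : Measurable X := hXm.mono hmle le_rfl
  have hYm : Measurable Y := measurable_pi_iff.2 hm
  have hind : IndepFun X Y P :=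
    (indep_of_indep_of_le_right hpast hXm.comap_le).symm
  have hSm : ∀ j, Measurable fun z : (H × (ℕ → H)) × (ℕ → ℝ) =>
      ∑ k ∈ Finset.range (ns j), z.2 k • z.1.2 k := fun j => by fun_prop
  have hC := measurableSet_exists_tendsto (l := atTop) hSm
  -- The subsequence `ns` was chosen before freezing, so one and the same `ns` serves almost all
  -- frozen coefficients.
  have hCae := ae_ae_of_indepFun hXm' hYm hind hC (by
    filter_upwards [hlim, haa] with ω hω hω'
    refine ⟨G ω, ?_⟩
    simpa only [hX, hY, hω'] using hω)
  -- `G` is not given as a function of coefficients and increments. The `liminf` along `ns` is a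
  -- measurable function of this pair and agrees almost surely with the quantity to be integrated.
  have hΦ : Measurable fun z : (H × (ℕ → H)) × (ℕ → ℝ) =>
      liminf (fun j => ‖z.1.1 + ∑ k ∈ Finset.range (ns j), z.2 k • z.1.2 k‖ₑ ^ 2) atTop :=
    Measurable.liminf fun j => by fun_prop
  calc ∫⁻ ω, ‖v ω + G ω‖ₑ ^ 2 ∂P
      = ∫⁻ ω, liminf (fun j => ‖(X ω).1 + ∑ k ∈ Finset.range (ns j), Y ω k • (X ω).2 k‖ₑ ^ 2)
          atTop ∂P := by
        refine lintegral_congr_ae ?_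
        filter_upwards [hlim, haa, hvv'] with ω hω hω' hω''
        simp only [hω', hω''] at hω ⊢
        exact (ENNReal.Tendsto.pow (tendsto_const_nhds.add hω).enorm).liminf_eq.symm
    _ = ∫⁻ ω, ∫⁻ ω', liminf (fun j => ‖(X ω).1
          + ∑ k ∈ Finset.range (ns j), Y ω' k • (X ω).2 k‖ₑ ^ 2) atTop ∂P ∂P :=
        lintegral_comp_prodMk_of_indepFun hXm' hYm hind hΦ
    _ = ∫⁻ ω, (‖v ω‖ₑ ^ 2 + V * ∑' k, ‖a k ω‖ₑ ^ 2) ∂P := by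
        refine lintegral_congr_ae ?_
        filter_upwards [hCae, haa, hvv', hfin] with ω hω hω' hω'' hfinω
        simp only [hω', hω''] at hfinω ⊢
        exact lintegral_liminf_enorm_add_sum_sq b hm hξ hlaw (v' ω) (fun k => a' k ω) hfinω hns hω
    _ = _ := by
        have h1 : AEMeasurable (fun ω => ‖v ω‖ₑ ^ 2) P :=
          ⟨fun ω => ‖v' ω‖ₑ ^ 2, (hv'.mono hmle).measurable.enorm.pow_const 2, by
            filter_upwards [hvv'] with ω hω
            rw [hω]⟩
        rw [lintegral_add_left' h1, lintegral_const_mul' _ _ ENNReal.coe_ne_top]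

/-- The partial sums satisfy the bound uniformly by freezing and `eLpNorm_normSq_sum_le`; Fatou
along an almost surely convergent subsequence passes it to `G`. -/
theorem lintegral_noise_sq_pow_le (b : HilbertBasis ℕ ℝ H) (hmle : m ≤ mΩ)
    (hm : ∀ k, Measurable (ξ k)) (hξ : iIndepFun ξ P)
    (hlaw : ∀ k, HasLaw (ξ k) (gaussianReal 0 V) P)
    (hpast : Indep (MeasurableSpace.comap (fun ω k => ξ k ω) MeasurableSpace.pi) m P)
    (ha : ∀ k, AEStronglyMeasurable[m] (a k) P)
    (hG : TendstoInMeasure P (fun (K : ℕ) ω => ∑ k ∈ Finset.range K, ξ k ω • a k ω) atTop G)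
    {p : ℕ} (hp : 1 ≤ p) :
    ∫⁻ ω, ‖‖G ω‖ ^ 2‖ₑ ^ p ∂P
      ≤ (V * gaussianSqNorm p) ^ p * ∫⁻ ω, (∑' k, ‖a k ω‖ₑ ^ 2) ^ p ∂P := by
  borelize H
  obtain ⟨ns, hns, hlim⟩ := hG.exists_seq_tendsto_ae
  choose a' ha' haa' using ha
  have haa : ∀ᵐ ω ∂P, ∀ k, a k ω = a' k ω := ae_all_iff.2 haa'
  set X : Ω → ℕ → H := fun ω k => a' k ω with hX
  set Y : Ω → ℕ → ℝ := fun ω k => ξ k ω with hY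
  have hXm : Measurable[m] X := @measurable_pi_lambda _ _ _ m _ _ fun k => (ha' k).measurable
  have hXm' : Measurable X := hXm.mono hmle le_rfl
  have hYm : Measurable Y := measurable_pi_iff.2 hm
  have hind : IndepFun X Y P :=
    (indep_of_indep_of_le_right hpast hXm.comap_le).symm
  have hΦ : ∀ j, Measurable fun z : (ℕ → H) × (ℕ → ℝ) =>
      ‖‖∑ k ∈ Finset.range (ns j), z.2 k • z.1 k‖ ^ 2‖ₑ ^ p := fun j => by fun_prop
  have hbound : ∀ j, ∫⁻ ω, ‖‖∑ k ∈ Finset.range (ns j), Y ω k • X ω k‖ ^ 2‖ₑ ^ p ∂P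
      ≤ (V * gaussianSqNorm p) ^ p * ∫⁻ ω, (∑' k, ‖a k ω‖ₑ ^ 2) ^ p ∂P := fun j => by
    rw [lintegral_comp_prodMk_of_indepFun hXm' hYm hind (hΦ j),
      ← lintegral_const_mul' _ _ (ENNReal.pow_ne_top (ENNReal.mul_ne_top ENNReal.coe_ne_top
        (gaussianSqNorm_lt_top p).ne))]
    refine lintegral_mono_ae ?_
    filter_upwards [haa] with ω hω
    rw [← eLpNorm_natCast_pow_eq_lintegral hp, ← mul_pow]
    gcongr
    refine (eLpNorm_normSq_sum_le b hm hξ hlaw (X ω) _ (by exact_mod_cast hp)).trans ?_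
    rw [mul_right_comm]
    gcongr
    simp only [hω]
    exact ENNReal.sum_le_tsum _
  have hlim' : ∀ᵐ ω ∂P, ‖‖G ω‖ ^ 2‖ₑ ^ p
      = liminf (fun j => ‖‖∑ k ∈ Finset.range (ns j), Y ω k • X ω k‖ ^ 2‖ₑ ^ p) atTop := by
    filter_upwards [hlim, haa] with ω hω hω'
    simp only [hω'] at hω
    have h1 := (hω.norm.pow 2).enorm
    have h2 := ENNReal.Tendsto.pow (n := p) h1
    exact h2.liminf_eq.symm
  rw [lintegral_congr_ae hlim']
  refine (lintegral_liminf_le fun j => (hΦ j).comp (hXm'.prodMk hYm)).trans ?_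
  refine liminf_le_of_le (by isBoundedDefault) fun B hB => ?_
  obtain ⟨j, hj⟩ := hB.exists
  exact hj.trans (hbound j)

end Noise

/-! ### Spectral calculus of the Dirichlet Laplacian in coefficients -/

section Spectral

variable {d : ℕ} {O : Set (EuclideanSpace ℝ (Fin d))} (E : DirichletEigenpairs O)

theorem coef_add (i : ℕ) (x y : L2 O) : E.coef i (x + y) = E.coef i x + E.coef i y :=
  inner_add_right _ _ _

theorem coef_sub (i : ℕ) (x y : L2 O) : E.coef i (x - y) = E.coef i x - E.coef i y :=
  inner_sub_right _ _ _

theorem coef_neg (i : ℕ) (x : L2 O) : E.coef i (-x) = -E.coef i x :=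
  inner_neg_right _ _

theorem coef_smul (i : ℕ) (c : ℝ) (x : L2 O) : E.coef i (c • x) = c * E.coef i x :=
  inner_smul_right _ _ _

theorem coef_zero (i : ℕ) : E.coef i (0 : L2 O) = 0 :=
  inner_zero_right _

theorem coef_basis (i j : ℕ) : E.coef i (E.basis j) = if i = j then 1 else 0 :=
  orthonormal_iff_ite.1 E.basis.orthonormal i j

theorem continuous_coef (i : ℕ) : Continuous (E.coef i) :=
  continuous_const.inner continuous_id

theorem hasSum_coef_mul (x y : L2 O) :
    HasSum (fun i => E.coef i x * E.coef i y) (inner ℝ x y) := by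
  refine (E.basis.hasSum_inner_mul_inner x y).congr_fun fun i => ?_
  rw [DirichletEigenpairs.coef, real_inner_comm]
  rfl

theorem hasSum_coef_sq (x : L2 O) : HasSum (fun i => E.coef i x ^ 2) (‖x‖ ^ 2) := by
  simpa only [sq, ← real_inner_self_eq_norm_mul_norm] using hasSum_coef_mul E x x

theorem coef_ext {x y : L2 O} (h : ∀ i, E.coef i x = E.coef i y) : x = y := by
  refine E.basis.repr.injective (lp.ext (funext fun i => ?_))
  rw [E.basis.repr_apply_apply, E.basis.repr_apply_apply]
  exact h i

theorem hasSum_hNorm_sq (u : E.Hdot1) :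
    HasSum (fun i => E.lam i * E.coef i (u : L2 O) ^ 2) (E.hNorm u ^ 2) := by
  have h : (fun i => E.lam i * E.coef i (u : L2 O) * E.coef i (u : L2 O))
      = fun i => E.lam i * E.coef i (u : L2 O) ^ 2 := by
    ext i
    ring
  have h0 : E.hInner u u = ∑' i, E.lam i * E.coef i (u : L2 O) ^ 2 := by
    rw [DirichletEigenpairs.hInner, h]
  rw [DirichletEigenpairs.hNorm, Real.sq_sqrt, h0]
  · exact u.2.hasSum
  · rw [h0]
    exact tsum_nonneg fun i => mul_nonneg (E.lam_pos i).le (sq_nonneg _)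

theorem hNorm_nonneg (u : E.Hdot1) : 0 ≤ E.hNorm u := Real.sqrt_nonneg _

theorem hNorm_smul (c : ℝ) (u : E.Hdot1) : E.hNorm (c • u) = |c| * E.hNorm u := by
  have h1 := hasSum_hNorm_sq E (c • u)
  have h2 := (hasSum_hNorm_sq E u).mul_left (c ^ 2)
  have h3 : E.hNorm (c • u) ^ 2 = c ^ 2 * E.hNorm u ^ 2 := by
    refine h1.unique (h2.congr_fun fun i => ?_)
    rw [Submodule.coe_smul, coef_smul]
    ring
  rw [← abs_of_nonneg (hNorm_nonneg E (c • u)), ← abs_of_nonneg (hNorm_nonneg E u), ← abs_mul,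
    ← sq_eq_sq_iff_abs_eq_abs, h3, mul_pow]

/-- The Poincaré inequality. -/
theorem lam_zero_mul_norm_sq_le (u : E.Hdot1) : E.lam 0 * ‖(u : L2 O)‖ ^ 2 ≤ E.hNorm u ^ 2 := by
  refine hasSum_le (fun i => ?_) ((hasSum_coef_sq E (u : L2 O)).mul_left (E.lam 0))
    (hasSum_hNorm_sq E u)
  gcongr
  exact E.lam_mono (Nat.zero_le i)

theorem norm_le_mul_hNorm : ∃ C : ℝ, 0 ≤ C ∧ ∀ u : E.Hdot1, ‖(u : L2 O)‖ ≤ C * E.hNorm u := by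
  refine ⟨(√(E.lam 0))⁻¹, by positivity, fun u => ?_⟩
  have h0 := E.lam_pos 0
  have h := Real.sqrt_le_sqrt (lam_zero_mul_norm_sq_le E u)
  rw [Real.sqrt_mul h0.le, Real.sqrt_sq (norm_nonneg _), Real.sqrt_sq (hNorm_nonneg E u)] at h
  rwa [inv_mul_eq_div, le_div_iff₀' (Real.sqrt_pos.2 h0)]

/-- Square summability makes the series defining `spec` converge; without convergence the `tsum`
would take its default value `0`. -/
theorem coef_spec {m : ℝ → ℝ} {x : L2 O}
    (h : Summable fun i => (m (E.lam i) * E.coef i x) ^ 2) (i : ℕ) :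
    E.coef i (E.spec m x) = m (E.lam i) * E.coef i x := by
  have hmem : Memℓp (fun i => m (E.lam i) * E.coef i x) 2 := by
    refine memℓp_gen (h.congr fun i => ?_)
    simp [mul_pow]
  have h1 := E.basis.hasSum_repr_symm ⟨_, hmem⟩
  have h2 : E.spec m x = E.basis.repr.symm ⟨_, hmem⟩ := h1.tsum_eq
  rw [DirichletEigenpairs.coef, ← E.basis.repr_apply_apply, h2,
    LinearIsometryEquiv.apply_symm_apply]

theorem coef_spec_of_le {m : ℝ → ℝ} {B : ℝ} (hB : ∀ i, |m (E.lam i)| ≤ B) (x : L2 O) (i : ℕ) :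
    E.coef i (E.spec m x) = m (E.lam i) * E.coef i x := by
  refine coef_spec E (Summable.of_nonneg_of_le (fun i => sq_nonneg _) (fun j => ?_)
    ((hasSum_coef_sq E x).summable.mul_left (B ^ 2))) i
  rw [mul_pow]
  refine mul_le_mul_of_nonneg_right ?_ (sq_nonneg _)
  exact sq_le_sq' (abs_le.1 (hB j)).1 (abs_le.1 (hB j)).2

theorem spec_zero (m : ℝ → ℝ) : E.spec m (0 : L2 O) = 0 := by
  simp [DirichletEigenpairs.spec, coef_zero]

theorem coef_spec_cos (t : ℝ) (x : L2 O) (i : ℕ) :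
    E.coef i (E.spec (fun l => Real.cos (t * √l)) x) = Real.cos (t * √(E.lam i)) * E.coef i x :=
  coef_spec_of_le E (m := fun l => Real.cos (t * √l)) (B := 1) (fun _ => Real.abs_cos_le_one _) x i

theorem coef_spec_sin_div (t : ℝ) (x : L2 O) (i : ℕ) :
    E.coef i (E.spec (fun l => (√l)⁻¹ * Real.sin (t * √l)) x)
      = (√(E.lam i))⁻¹ * Real.sin (t * √(E.lam i)) * E.coef i x := by
  refine coef_spec_of_le E (m := fun l => (√l)⁻¹ * Real.sin (t * √l)) (B := |t|) (fun j => ?_) x i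
  have hpos := Real.sqrt_pos.2 (E.lam_pos j)
  rw [abs_mul, abs_inv, abs_of_pos hpos, inv_mul_le_iff₀ hpos]
  refine Real.abs_sin_le_abs.trans ?_
  rw [abs_mul, abs_of_pos hpos, mul_comm]

theorem coef_spec_inv (x : L2 O) (i : ℕ) :
    E.coef i (E.spec (fun l => l⁻¹) x) = (E.lam i)⁻¹ * E.coef i x := by
  refine coef_spec_of_le E (m := fun l => l⁻¹) (B := (E.lam 0)⁻¹) (fun j => ?_) x i
  rw [abs_of_pos (inv_pos.2 (E.lam_pos j))]
  exact inv_anti₀ (E.lam_pos 0) (E.lam_mono (Nat.zero_le j))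

/-- The multiplier grows like `√λ`, so summability comes from membership in `Ḣ¹` and not from a
bound on the multiplier. -/
theorem coef_spec_mul_sin (t : ℝ) (u : E.Hdot1) (i : ℕ) :
    E.coef i (E.spec (fun l => √l * Real.sin (t * √l)) (u : L2 O))
      = √(E.lam i) * Real.sin (t * √(E.lam i)) * E.coef i (u : L2 O) := by
  refine coef_spec E (m := fun l => √l * Real.sin (t * √l))
    (Summable.of_nonneg_of_le (fun i => sq_nonneg _) (fun j => ?_) u.2) i
  have h0 := (E.lam_pos j).le
  have h1 : Real.sin (t * √(E.lam j)) ^ 2 ≤ 1 := Real.sin_sq_le_one _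
  have h2 := mul_nonneg h0 (sq_nonneg (E.coef j (u : L2 O)))
  rw [mul_pow, mul_pow, Real.sq_sqrt h0]
  nlinarith

/-- The eigenfunction `e_i` as an element of `Ḣ¹`. -/
def eigenvector (i : ℕ) : E.Hdot1 :=
  ⟨E.basis i, by
    refine summable_of_ne_finset_zero (s := {i}) fun j hj => ?_
    rw [coef_basis, if_neg (by simpa using hj)]
    simp⟩

theorem hInner_eigenvector (u : E.Hdot1) (i : ℕ) :
    E.hInner u (eigenvector E i) = E.lam i * E.coef i (u : L2 O) := by
  rw [DirichletEigenpairs.hInner, tsum_eq_single i]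
  · simp [eigenvector, coef_basis]
  · intro j hj
    simp [eigenvector, coef_basis, hj]

end Spectral

/-! ### One time step, mode by mode -/

section Steps

variable {d : ℕ} {O : Set (EuclideanSpace ℝ (Fin d))} (E : DirichletEigenpairs O)

/-- Coefficientwise form of one time step with noise `G` and force `b`: the new values are affine
in the old ones, and the energy balance holds for each coefficient. -/
structure CoefStep (p r κ p' r' κ' : ℕ → ℝ) (G b : L2 O) (u u' : E.Hdot1) (v v' : L2 O) :
    Prop where
  coef_fst : ∀ i, E.coef i (u' : L2 O)
    = p i * E.coef i (u : L2 O) + r i * E.coef i (v + G) - κ i * E.coef i b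
  coef_snd : ∀ i, E.coef i v'
    = p' i * E.coef i (u : L2 O) + r' i * E.coef i (v + G) - κ' i * E.coef i b
  balance : ∀ i, E.lam i * E.coef i (u' : L2 O) ^ 2 + E.coef i v' ^ 2
      + 2 * (E.coef i b * E.coef i ((u' - u : E.Hdot1) : L2 O))
    = E.lam i * E.coef i (u : L2 O) ^ 2 + E.coef i (v + G) ^ 2

/-- Testing with eigenvectors gives a 2×2 linear system in each mode. The solution coefficients
depend only on `τ` and the spectrum, which is why they are quantified before the step data.
Nonnegativity and boundedness of `κ` serve later to solve for `q'`. -/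
theorem exists_coefStep_midpoint {τ : ℝ} (hτ : 0 < τ) :
    ∃ p r κ p' r' κ' : ℕ → ℝ, (∃ B, ∀ i, 0 ≤ κ i ∧ κ i ≤ B) ∧
      ∀ (Ft : ℝ → ℝ) (f : E.Hdot1 → L2 O) (δ : ℝ) (hat : E.Hdot1) (G : L2 O)
        (u u' : E.Hdot1) (v v' : L2 O) (q q' : ℝ),
        MidpointStep Ft f δ τ hat G u u' v v' q q' →
        CoefStep E p r κ p' r' κ' G (savForce Ft f δ hat q q') u u' v v' := by
  have hD : ∀ i, 0 < 1 + τ ^ 2 / 4 * E.lam i := fun i => by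
    have := E.lam_pos i
    positivity
  refine ⟨fun i => (1 - τ ^ 2 / 4 * E.lam i) / (1 + τ ^ 2 / 4 * E.lam i),
    fun i => τ / (1 + τ ^ 2 / 4 * E.lam i),
    fun i => (τ ^ 2 / 2) / (1 + τ ^ 2 / 4 * E.lam i),
    fun i => - (τ * E.lam i) / (1 + τ ^ 2 / 4 * E.lam i),
    fun i => (1 - τ ^ 2 / 4 * E.lam i) / (1 + τ ^ 2 / 4 * E.lam i),
    fun i => τ / (1 + τ ^ 2 / 4 * E.lam i),
    ⟨τ ^ 2 / 2, fun i => ⟨?_, ?_⟩⟩, ?_⟩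
  · have := hD i
    positivity
  · refine div_le_self (by positivity) ?_
    have := E.lam_pos i
    have : 0 ≤ τ ^ 2 / 4 * E.lam i := by positivity
    linarith
  intro Ft f δ hat G u u' v v' q q' hstep
  obtain ⟨h1, h2, -⟩ := hstep
  have hu : ∀ i, E.coef i (u' : L2 O)
      = E.coef i (u : L2 O) + τ / 2 * (E.coef i (v + G) + E.coef i v') := fun i => by
    rw [h1]
    simp only [coef_add, coef_smul]
    ring
  have hv : ∀ i, E.coef i v' = E.coef i (v + G)
      - τ / 2 * (E.lam i * (E.coef i (u : L2 O) + E.coef i (u' : L2 O)))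
      - τ * E.coef i (savForce Ft f δ hat q q') := fun i => by
    have h := h2 (eigenvector E i)
    rw [hInner_eigenvector, Submodule.coe_add, coef_add] at h
    simp only [eigenvector, real_inner_comm (E.basis i)] at h
    simp only [coef_add]
    simp only [DirichletEigenpairs.coef] at h ⊢
    linarith
  refine ⟨fun i => ?_, fun i => ?_, fun i => ?_⟩
  · have hu := hu i
    have hv := hv i
    have hD := hD i
    have h : E.coef i (u' : L2 O) * (1 + τ ^ 2 / 4 * E.lam i)
        = (1 - τ ^ 2 / 4 * E.lam i) * E.coef i (u : L2 O) + τ * E.coef i (v + G)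
          - τ ^ 2 / 2 * E.coef i (savForce Ft f δ hat q q') := by
      linear_combination hu + τ / 2 * hv
    rw [← eq_div_iff hD.ne'] at h
    rw [h]
    ring
  · have hu := hu i
    have hv := hv i
    have hD := hD i
    have h : E.coef i v' * (1 + τ ^ 2 / 4 * E.lam i)
        = - (τ * E.lam i) * E.coef i (u : L2 O) + (1 - τ ^ 2 / 4 * E.lam i) * E.coef i (v + G)
          - τ * E.coef i (savForce Ft f δ hat q q') := by
      linear_combination hv - τ / 2 * E.lam i * hu
    rw [← eq_div_iff hD.ne'] at h
    rw [h]
    ring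
  · have hu := hu i
    have hv := hv i
    rw [Submodule.coe_sub, coef_sub]
    have h3 : τ * (E.lam i * E.coef i (u' : L2 O) ^ 2 + E.coef i v' ^ 2
        + 2 * (E.coef i (savForce Ft f δ hat q q')
          * (E.coef i (u' : L2 O) - E.coef i (u : L2 O))))
        = τ * (E.lam i * E.coef i (u : L2 O) ^ 2 + E.coef i (v + G) ^ 2) := by
      -- The velocity equation is multiplied by `v' + (v + G)` and the position equation by `λ (u +
      -- u') + 2 b`; the right-hand sides then cancel.
      linear_combination τ * (E.coef i v' + E.coef i (v + G)) * hv
        + τ * (E.lam i * (E.coef i (u : L2 O) + E.coef i (u' : L2 O))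
          + 2 * E.coef i (savForce Ft f δ hat q q')) * hu
    exact mul_left_cancel₀ hτ.ne' h3

/-- In each mode the step is the exact flow of the oscillator under a constant force: a rotation of
`(√λ u, v)` about the shifted equilibrium. The bound on `κ` uses `1 - cos ≤ 2` and the smallest
eigenvalue. -/
theorem exists_coefStep_exponential (τ : ℝ) :
    ∃ p r κ p' r' κ' : ℕ → ℝ, (∃ B, ∀ i, 0 ≤ κ i ∧ κ i ≤ B) ∧
      ∀ (Ft : ℝ → ℝ) (f : E.Hdot1 → L2 O) (δ : ℝ) (hat : E.Hdot1) (G : L2 O)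
        (u u' : E.Hdot1) (v v' : L2 O) (q q' : ℝ),
        ExponentialStep Ft f δ τ hat G u u' v v' q q' →
        CoefStep E p r κ p' r' κ' G (savForce Ft f δ hat q q') u u' v v' := by
  refine ⟨fun i => Real.cos (τ * √(E.lam i)),
    fun i => (√(E.lam i))⁻¹ * Real.sin (τ * √(E.lam i)),
    fun i => (E.lam i)⁻¹ * (1 - Real.cos (τ * √(E.lam i))),
    fun i => - (√(E.lam i) * Real.sin (τ * √(E.lam i))),
    fun i => Real.cos (τ * √(E.lam i)),
    fun i => (√(E.lam i))⁻¹ * Real.sin (τ * √(E.lam i)),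
    ⟨(E.lam 0)⁻¹ * 2, fun i => ⟨?_, ?_⟩⟩, ?_⟩
  · exact mul_nonneg (inv_nonneg.2 (E.lam_pos i).le)
      (by linarith [Real.cos_le_one (τ * √(E.lam i))])
  · refine mul_le_mul (inv_anti₀ (E.lam_pos 0) (E.lam_mono (Nat.zero_le i)))
      (by linarith [Real.neg_one_le_cos (τ * √(E.lam i))])
      (by linarith [Real.cos_le_one (τ * √(E.lam i))]) (inv_nonneg.2 (E.lam_pos 0).le)
  intro Ft f δ hat G u u' v v' q q' hstep
  obtain ⟨h1, -⟩ := hstep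
  set b := savForce Ft f δ hat q q'
  have hu : ∀ i, E.coef i (u' : L2 O) = Real.cos (τ * √(E.lam i)) * E.coef i (u : L2 O)
      + (√(E.lam i))⁻¹ * Real.sin (τ * √(E.lam i)) * E.coef i (v + G)
      - (E.lam i)⁻¹ * (1 - Real.cos (τ * √(E.lam i))) * E.coef i b := fun i => by
    have h := congrArg (fun z => E.coef i z.1) h1
    simp only [DirichletEigenpairs.group, DirichletEigenpairs.invA, Prod.fst_add, Prod.snd_sub,
      coef_add, coef_neg, coef_spec_cos, coef_spec_sin_div, coef_spec_inv, coef_sub,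
      Submodule.coe_zero, spec_zero, coef_zero] at h
    rw [h, coef_add]
    ring
  have hv : ∀ i, E.coef i v' = - (√(E.lam i) * Real.sin (τ * √(E.lam i))) * E.coef i (u : L2 O)
      + Real.cos (τ * √(E.lam i)) * E.coef i (v + G)
      - (√(E.lam i))⁻¹ * Real.sin (τ * √(E.lam i)) * E.coef i b := fun i => by
    have h := congrArg (fun z => E.coef i z.2) h1
    simp only [DirichletEigenpairs.group, DirichletEigenpairs.invA, Prod.snd_add, Prod.fst_sub,
      coef_add, coef_neg, coef_spec_cos, coef_spec_sin_div, coef_sub,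
      coef_spec_mul_sin, Submodule.coe_zero, spec_zero, coef_zero] at h
    rw [h, coef_add]
    ring
  refine ⟨hu, hv, fun i => ?_⟩
  rw [Submodule.coe_sub, coef_sub, hu i, hv i]
  have hl := Real.sqrt_pos.2 (E.lam_pos i)
  have hsq : E.lam i = √(E.lam i) ^ 2 := (Real.sq_sqrt (E.lam_pos i).le).symm
  have hcs := Real.sin_sq_add_cos_sq (τ * √(E.lam i))
  set l := √(E.lam i)
  rw [hsq]
  set s := Real.sin (τ * l)
  set c := Real.cos (τ * l)
  set x := E.coef i (u : L2 O)
  set w := E.coef i (v + G)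
  set y := E.coef i b
  have hs : s ^ 2 = 1 - c ^ 2 := by linarith
  field_simp
  ring_nf
  rw [show s ^ 2 = 1 - c ^ 2 from hs]
  ring

end Steps

/-! ### The norm of `Ḣ¹` and continuity with respect to it -/

section EnergyNorm

variable {d : ℕ} {O : Set (EuclideanSpace ℝ (Fin d))} (E : DirichletEigenpairs O)

theorem coef_spec_sqrt (u : E.Hdot1) (i : ℕ) :
    E.coef i (E.spec Real.sqrt (u : L2 O)) = √(E.lam i) * E.coef i (u : L2 O) := by
  refine coef_spec E (u.2.congr fun i => ?_) i
  rw [mul_pow, Real.sq_sqrt (E.lam_pos i).le]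

/-- Realising the `Ḣ¹` norm as an `L²` norm lets the triangle inequality be inherited from `L²`. -/
theorem hNorm_eq_norm_spec_sqrt (u : E.Hdot1) :
    E.hNorm u = ‖E.spec Real.sqrt (u : L2 O)‖ := by
  have h : E.hNorm u ^ 2 = ‖E.spec Real.sqrt (u : L2 O)‖ ^ 2 := by
    refine (hasSum_hNorm_sq E u).unique ((hasSum_coef_sq E _).congr_fun fun i => ?_)
    rw [coef_spec_sqrt, mul_pow, Real.sq_sqrt (E.lam_pos i).le]
  exact (sq_eq_sq₀ (hNorm_nonneg E u) (norm_nonneg _)).1 h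

theorem hNorm_add_le (u w : E.Hdot1) : E.hNorm (u + w) ≤ E.hNorm u + E.hNorm w := by
  simp only [hNorm_eq_norm_spec_sqrt]
  have h : E.spec Real.sqrt ((u + w : E.Hdot1) : L2 O)
      = E.spec Real.sqrt (u : L2 O) + E.spec Real.sqrt (w : L2 O) := by
    refine coef_ext E fun i => ?_
    rw [coef_add, coef_spec_sqrt, coef_spec_sqrt, coef_spec_sqrt, Submodule.coe_add, coef_add]
    ring
  rw [h]
  exact norm_add_le _ _

theorem hNorm_sub_comm (u w : E.Hdot1) : E.hNorm (u - w) = E.hNorm (w - u) := by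
  rw [← neg_sub w u, ← neg_one_smul ℝ, hNorm_smul]
  simp

theorem abs_hNorm_sub_le (u w : E.Hdot1) : |E.hNorm u - E.hNorm w| ≤ E.hNorm (u - w) := by
  have h1 := hNorm_add_le E (u - w) w
  have h2 := hNorm_add_le E (w - u) u
  rw [sub_add_cancel] at h1 h2
  rw [hNorm_sub_comm E w u] at h2
  exact abs_le.2 ⟨by linarith, by linarith⟩

theorem hNorm_zero : E.hNorm 0 = 0 := by
  simpa using hNorm_smul E 0 0

/-- Sequential continuity with respect to the norm of `Ḣ¹`. -/
def EnergyContinuous {F : Type*} [TopologicalSpace F] (Φ : E.Hdot1 → F) : Prop :=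
  ∀ (w : ℕ → E.Hdot1) (u : E.Hdot1), Tendsto (fun n => E.hNorm (w n - u)) atTop (𝓝 0) →
    Tendsto (fun n => Φ (w n)) atTop (𝓝 (Φ u))

theorem energyContinuous_hNorm : EnergyContinuous E E.hNorm := fun w u h => by
  rw [tendsto_iff_norm_sub_tendsto_zero]
  exact squeeze_zero (fun n => norm_nonneg _) (fun n => abs_hNorm_sub_le E (w n) u) h

theorem energyContinuous_of_norm_sub_le {F : Type*} [SeminormedAddCommGroup F] {Φ : E.Hdot1 → F}
    {B : ℝ → ℝ → ℝ} (hB : Continuous fun z : ℝ × ℝ => B z.1 z.2)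
    (h : ∀ u w, ‖Φ u - Φ w‖ ≤ B (E.hNorm u) (E.hNorm w) * E.hNorm (u - w)) :
    EnergyContinuous E Φ := fun w u hw => by
  rw [tendsto_iff_norm_sub_tendsto_zero]
  have h1 := energyContinuous_hNorm E w u hw
  have h2 : Tendsto (fun n => B (E.hNorm (w n)) (E.hNorm u)) atTop
      (𝓝 (B (E.hNorm u) (E.hNorm u))) :=
    hB.continuousAt.tendsto.comp (h1.prodMk_nhds tendsto_const_nhds)
  have h3 := h2.mul hw
  rw [mul_zero] at h3
  exact squeeze_zero (fun n => norm_nonneg _) (fun n => h (w n) u) h3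

/-- The element of `Ḣ¹` with the first `M` coefficients `c 0, …, c (M - 1)`. -/
def ofCoefs (M : ℕ) (c : ℕ → ℝ) : E.Hdot1 := ∑ i ∈ Finset.range M, c i • eigenvector E i

theorem coe_ofCoefs (M : ℕ) (c : ℕ → ℝ) :
    (ofCoefs E M c : L2 O) = ∑ i ∈ Finset.range M, c i • E.basis i := by
  simp [ofCoefs, eigenvector]

theorem coef_ofCoefs (M : ℕ) (c : ℕ → ℝ) (j : ℕ) :
    E.coef j (ofCoefs E M c : L2 O) = if j ∈ Finset.range M then c j else 0 := by
  have h : E.coef j (ofCoefs E M c : L2 O)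
      = ∑ i ∈ Finset.range M, c i * E.coef j (E.basis i) := by
    rw [coe_ofCoefs, DirichletEigenpairs.coef, inner_sum]
    exact Finset.sum_congr rfl fun i _ => inner_smul_right _ _ _
  simp [h, coef_basis]

theorem hNorm_ofCoefs_sq (M : ℕ) (c : ℕ → ℝ) :
    E.hNorm (ofCoefs E M c) ^ 2 = ∑ i ∈ Finset.range M, E.lam i * c i ^ 2 := by
  refine (hasSum_hNorm_sq E _).unique ?_
  have h := hasSum_sum_of_ne_finset_zero (f := fun i => E.lam i
    * E.coef i (ofCoefs E M c : L2 O) ^ 2) (s := Finset.range M) (L := .unconditional ℕ) fun i hi => by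
      rw [coef_ofCoefs, if_neg hi]
      simp
  rwa [Finset.sum_congr rfl fun i hi => by rw [coef_ofCoefs, if_pos hi]] at h

theorem ofCoefs_sub (M : ℕ) (c c' : ℕ → ℝ) :
    ofCoefs E M c - ofCoefs E M c' = ofCoefs E M (c - c') := by
  simp [ofCoefs, sub_smul]

theorem tendsto_hNorm_zero_of_sq {w : ℕ → E.Hdot1}
    (h : Tendsto (fun n => E.hNorm (w n) ^ 2) atTop (𝓝 0)) :
    Tendsto (fun n => E.hNorm (w n)) atTop (𝓝 0) := by
  have h1 := (Real.continuous_sqrt.tendsto 0).comp h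
  rw [Real.sqrt_zero] at h1
  exact h1.congr fun n => Real.sqrt_sq (hNorm_nonneg E _)

/-- Only finitely many coordinates enter, so coordinatewise convergence already gives convergence in
`Ḣ¹`. -/
theorem continuous_comp_ofCoefs {F : Type*} [TopologicalSpace F] {Φ : E.Hdot1 → F}
    (hΦ : EnergyContinuous E Φ) (M : ℕ) : Continuous fun c => Φ (ofCoefs E M c) := by
  refine SeqContinuous.continuous fun c c₀ hc => hΦ _ _ (tendsto_hNorm_zero_of_sq E ?_)
  simp_rw [ofCoefs_sub, hNorm_ofCoefs_sq]
  have h : Tendsto (fun n => ∑ i ∈ Finset.range M, E.lam i * (c n - c₀) i ^ 2) atTop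
      (𝓝 (∑ i ∈ Finset.range M, E.lam i * 0 ^ 2)) := by
    refine tendsto_finsetSum _ fun i _ => Tendsto.const_mul _ (Tendsto.pow ?_ 2)
    have := ((tendsto_pi_nhds.1 hc i).sub_const (c₀ i))
    simpa using this
  simpa using h

theorem tendsto_hNorm_truncation (u : E.Hdot1) :
    Tendsto (fun M => E.hNorm (ofCoefs E M (fun i => E.coef i (u : L2 O)) - u)) atTop (𝓝 0) := by
  refine tendsto_hNorm_zero_of_sq E ?_
  have h : ∀ M, E.hNorm (ofCoefs E M (fun i => E.coef i (u : L2 O)) - u) ^ 2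
      = E.hNorm u ^ 2 - ∑ i ∈ Finset.range M, E.lam i * E.coef i (u : L2 O) ^ 2 := fun M => by
    have h1 := hasSum_hNorm_sq E (ofCoefs E M (fun i => E.coef i (u : L2 O)) - u)
    have h2 := hasSum_hNorm_sq E (ofCoefs E M (fun i => E.coef i (u : L2 O)))
    rw [hNorm_ofCoefs_sq] at h2
    refine h1.unique (((hasSum_hNorm_sq E u).sub h2).congr_fun fun i => ?_)
    rw [Submodule.coe_sub, coef_sub, coef_ofCoefs]
    split_ifs <;> ring
  simp_rw [h]
  have h3 := (hasSum_hNorm_sq E u).tendsto_sum_nat.const_sub (E.hNorm u ^ 2)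
  rwa [sub_self] at h3

end EnergyNorm

/-! ### Measurability of functions continuous on `Ḣ¹` -/

section AEMeas

variable {Ω : Type*} {m mΩ : MeasurableSpace Ω} {P : Measure Ω}

theorem aestronglyMeasurable_fun_sum_sub {F : Type*} [AddCommMonoid F] [TopologicalSpace F]
    [ContinuousAdd F] {f : ℕ → Ω → F} (I : Finset ℕ) (hf : ∀ k, AEStronglyMeasurable[m] (f k) P) :
    AEStronglyMeasurable[m] (fun ω => ∑ k ∈ I, f k ω) P := by
  choose f' hf' hff' using hf
  refine ⟨fun ω => ∑ k ∈ I, f' k ω, Finset.stronglyMeasurable_fun_sum _ fun k _ => hf' k, ?_⟩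
  filter_upwards [ae_all_iff.2 hff'] with ω hω
  simp only [hω]

theorem aestronglyMeasurable_comp_pi {F : Type*} [TopologicalSpace F] {f : ℕ → Ω → ℝ}
    {φ : (ℕ → ℝ) → F} (hφ : Continuous φ) (hf : ∀ k, AEStronglyMeasurable[m] (f k) P) :
    AEStronglyMeasurable[m] (fun ω => φ fun k => f k ω) P := by
  choose f' hf' hff' using hf
  have h : Measurable[m] fun ω k => f' k ω :=
    @measurable_pi_lambda _ _ _ m _ _ fun k => (hf' k).measurable
  refine ⟨fun ω => φ fun k => f' k ω, hφ.comp_stronglyMeasurable h.stronglyMeasurable, ?_⟩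
  filter_upwards [ae_all_iff.2 hff'] with ω hω
  simp only [hω]

variable {d : ℕ} {O : Set (EuclideanSpace ℝ (Fin d))} (E : DirichletEigenpairs O)

theorem aestronglyMeasurable_coef {x : Ω → L2 O} (hx : AEStronglyMeasurable[m] x P) (i : ℕ) :
    AEStronglyMeasurable[m] (fun ω => E.coef i (x ω)) P :=
  (continuous_coef E i).comp_aestronglyMeasurable hx

theorem aestronglyMeasurable_of_coef {x : Ω → L2 O}
    (hx : ∀ i, AEStronglyMeasurable[m] (fun ω => E.coef i (x ω)) P) :
    AEStronglyMeasurable[m] x P := by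
  refine aestronglyMeasurable_of_tendsto_ae_sub
    (f := fun M ω => ∑ i ∈ Finset.range M, E.coef i (x ω) • E.basis i) (fun M => ?_)
    (ae_of_all _ fun ω => ?_)
  · exact aestronglyMeasurable_fun_sum_sub _ fun i => (hx i).smul_const _
  · have h := (E.basis.hasSum_repr (x ω)).tendsto_sum_nat
    simp only [E.basis.repr_apply_apply] at h
    exact h

/-- Although `u` is measurable only as an `L²`-valued map, its spectral truncations are measurable
functions of countably many coefficients and converge to it in `Ḣ¹`. -/
theorem aestronglyMeasurable_energyContinuous_comp {F : Type*} [TopologicalSpace F]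
    [TopologicalSpace.IsCompletelyMetrizableSpace F] {Φ : E.Hdot1 → F}
    (hΦ : EnergyContinuous E Φ) {u : Ω → E.Hdot1}
    (hu : AEStronglyMeasurable[m] (fun ω => (u ω : L2 O)) P) :
    AEStronglyMeasurable[m] (fun ω => Φ (u ω)) P :=
  aestronglyMeasurable_of_tendsto_ae_sub
    (f := fun M ω => Φ (ofCoefs E M fun i => E.coef i (u ω : L2 O)))
    (fun M => aestronglyMeasurable_comp_pi (continuous_comp_ofCoefs E hΦ M)
      fun i => aestronglyMeasurable_coef E hu i)
    (ae_of_all _ fun ω => hΦ _ _ (tendsto_hNorm_truncation E (u ω)))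

end AEMeas

/-! ### Energy balance and solvability for the auxiliary variable -/

section AuxiliaryVariable

variable {d : ℕ} {O : Set (EuclideanSpace ℝ (Fin d))} {E : DirichletEigenpairs O}
  {Ft : ℝ → ℝ} {f : E.Hdot1 → L2 O} {δ : ℝ} {hat u u' : E.Hdot1} {v v' G : L2 O} {q q' : ℝ}
  {p r κ p' r' κ' : ℕ → ℝ}

theorem modEnergy_step
    (h : CoefStep E p r κ p' r' κ' G (savForce Ft f δ hat q q') u u' v v')
    (haux : AuxStep Ft f δ hat u u' q q') (hpos : 0 < potential Ft hat + δ) :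
    modEnergy E u' v' q' = modEnergy E u (v + G) q := by
  have h1 := ((hasSum_hNorm_sq E u').add (hasSum_coef_sq E v')).add
    ((hasSum_coef_mul E (savForce Ft f δ hat q q') ((u' - u : E.Hdot1) : L2 O)).mul_left 2)
  have h2 := (hasSum_hNorm_sq E u).add (hasSum_coef_sq E (v + G))
  have h3 := h1.unique (h2.congr_fun fun i => h.balance i)
  have hs := Real.sqrt_pos.2 hpos
  rw [AuxStep] at haux
  rw [savForce, real_inner_smul_left] at h3
  set s := √(potential Ft hat + δ)
  set J : ℝ := inner ℝ (f hat) ((u' - u : E.Hdot1) : L2 O)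
  -- Solved for the work term, the auxiliary update makes the force contribution telescope into `q'²
  -- - q²`.
  have hJ : J = 2 * s * (q' - q) := by
    rw [haux]
    field_simp
    ring
  rw [hJ] at h3
  have h4 : (q + q') / 2 / s * (2 * s * (q' - q)) = q' ^ 2 - q ^ 2 := by
    field_simp
    ring
  rw [h4] at h3
  simp only [modEnergy]
  linarith

/-- The auxiliary variable after one step solves a scalar linear equation; this is its solution with
all series truncated after `M` terms. -/
def auxTruncation (E : DirichletEigenpairs O) (p r κ : ℕ → ℝ) (M : ℕ) (s : ℝ) (x u w : L2 O)
    (q : ℝ) : ℝ :=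
  (q + (∑ i ∈ Finset.range M,
      E.coef i x * (p i * E.coef i u + r i * E.coef i w - E.coef i u)) / (2 * s)
    - q * (∑ i ∈ Finset.range M, κ i * E.coef i x ^ 2) / (4 * s ^ 2))
  / (1 + (∑ i ∈ Finset.range M, κ i * E.coef i x ^ 2) / (4 * s ^ 2))

/-- Inserting the modewise formula for `u'` into the update gives `q' (1 + K / (4 s²)) = q + D / (2
s) - q K / (4 s²)`, where `K = ∑ κ_i x_i² ≥ 0`. The left factor is positive, so `q'` is determined
by the old data. -/
theorem tendsto_auxTruncation {B : ℝ} (hκ : ∀ i, 0 ≤ κ i ∧ κ i ≤ B)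
    (h : CoefStep E p r κ p' r' κ' G (savForce Ft f δ hat q q') u u' v v')
    (haux : AuxStep Ft f δ hat u u' q q') (hpos : 0 < potential Ft hat + δ) :
    Tendsto (fun M => auxTruncation E p r κ M √(potential Ft hat + δ) (f hat) (u : L2 O) (v + G) q)
      atTop (𝓝 q') := by
  have hs := Real.sqrt_pos.2 hpos
  rw [AuxStep] at haux
  have hcoef := h.coef_fst
  simp only [savForce, coef_smul] at hcoef
  set s := √(potential Ft hat + δ)
  set x := f hat
  have hK : Summable fun i => κ i * E.coef i x ^ 2 :=
    Summable.of_nonneg_of_le (fun i => mul_nonneg (hκ i).1 (sq_nonneg _))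
      (fun i => mul_le_mul_of_nonneg_right (hκ i).2 (sq_nonneg _))
      ((hasSum_coef_sq E x).summable.mul_left B)
  have hK0 : 0 ≤ ∑' i, κ i * E.coef i x ^ 2 :=
    tsum_nonneg fun i => mul_nonneg (hκ i).1 (sq_nonneg _)
  have hKsum := hK.hasSum
  set K := ∑' i, κ i * E.coef i x ^ 2
  have hJ := hasSum_coef_mul E x ((u' - u : E.Hdot1) : L2 O)
  set J : ℝ := inner ℝ x ((u' - u : E.Hdot1) : L2 O)
  -- Convergence of this series is read off from the given solution, so no bounds on `p` and `r` are
  -- needed.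
  have hD : HasSum (fun i => E.coef i x * (p i * E.coef i (u : L2 O) + r i * E.coef i (v + G)
      - E.coef i (u : L2 O))) (J + (q + q') / 2 / s * K) := by
    refine (hJ.add (hKsum.mul_left ((q + q') / 2 / s))).congr_fun fun i => ?_
    rw [Submodule.coe_sub, coef_sub, hcoef i]
    ring
  have hlim : Tendsto (fun M => auxTruncation E p r κ M s x (u : L2 O) (v + G) q) atTop
      (𝓝 ((q + (J + (q + q') / 2 / s * K) / (2 * s) - q * K / (4 * s ^ 2))
        / (1 + K / (4 * s ^ 2)))) := by
    refine Tendsto.div ?_ ?_ (by positivity)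
    · exact (tendsto_const_nhds.add (hD.tendsto_sum_nat.div_const _)).sub
        ((hKsum.tendsto_sum_nat.const_mul q).div_const _)
    · exact tendsto_const_nhds.add (hKsum.tendsto_sum_nat.div_const _)
  convert hlim using 2
  have hJ' : J = 2 * s * (q' - q) := by
    rw [haux]
    field_simp
    ring
  rw [hJ', eq_div_iff (by positivity)]
  field_simp
  ring

end AuxiliaryVariable

/-! ### Local Lipschitz bound for the potential -/

section Potential

variable {d : ℕ} {O : Set (EuclideanSpace ℝ (Fin d))} {E : DirichletEigenpairs O}

/-- `F` is merely differentiable, so its derivative may fail to be integrable along the segment. In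
that case the right-hand side is infinite; otherwise the fundamental theorem of calculus applies. -/
theorem enorm_sub_le_lintegral_deriv_segment {F : ℝ → ℝ} (hF : Differentiable ℝ F) (a c : ℝ) :
    ‖F a - F c‖ₑ ≤ ∫⁻ s in Set.Ioc (0 : ℝ) 1, ‖deriv F (c + s * (a - c)) * (a - c)‖ₑ := by
  by_cases hfin : ∫⁻ s in Set.Ioc (0 : ℝ) 1, ‖deriv F (c + s * (a - c)) * (a - c)‖ₑ = ∞
  · rw [hfin]
    exact le_top
  have hm : Measurable fun s : ℝ => deriv F (c + s * (a - c)) * (a - c) :=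
    ((measurable_deriv F).comp (by fun_prop)).mul_const _
  have hint : IntervalIntegrable (fun s : ℝ => deriv F (c + s * (a - c)) * (a - c)) volume 0 1 :=
    (intervalIntegrable_iff_integrableOn_Ioc_of_le zero_le_one).2
      ⟨hm.aestronglyMeasurable, lt_top_iff_ne_top.2 hfin⟩
  have hder : ∀ s ∈ Set.uIcc (0 : ℝ) 1,
      HasDerivAt (fun s => F (c + s * (a - c))) (deriv F (c + s * (a - c)) * (a - c)) s := by
    intro s _
    have h1 : HasDerivAt (fun s : ℝ => c + s * (a - c)) (a - c) s := by
      simpa using ((hasDerivAt_id s).mul_const (a - c)).const_add c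
    exact (hF _).hasDerivAt.comp s h1
  have h := intervalIntegral.integral_eq_sub_of_hasDerivAt hder hint
  simp only [one_mul, zero_mul, add_zero, add_sub_cancel] at h
  rw [← h, intervalIntegral.integral_of_le zero_le_one]
  exact enorm_integral_le_lintegral_enorm _

theorem lintegral_enorm_mul_le {α : Type*} {mα : MeasurableSpace α} {μ : Measure α}
    (x y : Lp ℝ 2 μ) : ∫⁻ t, ‖x t * y t‖ₑ ∂μ ≤ ENNReal.ofReal (‖x‖ * ‖y‖) := by
  have h := eLpNorm_smul_le_mul_eLpNorm (p := 2) (q := 2) (r := 1) (μ := μ) (f := (y : α → ℝ))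
    (φ := (x : α → ℝ)) (Lp.aestronglyMeasurable _) (Lp.aestronglyMeasurable _)
  rw [eLpNorm_one_eq_lintegral_enorm, ← Lp.enorm_def, ← Lp.enorm_def, ← ofReal_norm,
    ← ofReal_norm, ← ENNReal.ofReal_mul (norm_nonneg _)] at h
  exact h

/-- The pointwise segment bound is integrated over `O`. Tonelli moves the segment parameter outside,
where the derivative is `f` at an intermediate point and Cauchy–Schwarz applies. -/
theorem abs_potential_sub_le {Ft : ℝ → ℝ} {f : E.Hdot1 → L2 O} (hF : Differentiable ℝ Ft)
    (hf : ∀ u, (f u : EuclideanSpace ℝ (Fin d) → ℝ)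
      =ᵐ[volume.restrict O] fun x => deriv Ft ((u : L2 O) x))
    (hint : ∀ u : E.Hdot1, IntegrableOn (fun x => Ft ((u : L2 O) x)) O) {u w : E.Hdot1} {C : ℝ}
    (hC : ∀ s ∈ Set.Ioc (0 : ℝ) 1, ‖f (w + s • (u - w))‖ ≤ C) :
    |potential Ft u - potential Ft w| ≤ C * ‖((u - w : E.Hdot1) : L2 O)‖ := by
  have hC0 : 0 ≤ C := (norm_nonneg _).trans (hC 1 (by simp))
  set μ := volume.restrict O
  have hUm : Measurable ((u : L2 O) : EuclideanSpace ℝ (Fin d) → ℝ) :=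
    (Lp.stronglyMeasurable _).measurable
  have hWm : Measurable ((w : L2 O) : EuclideanSpace ℝ (Fin d) → ℝ) :=
    (Lp.stronglyMeasurable _).measurable
  have hm : Measurable fun z : EuclideanSpace ℝ (Fin d) × ℝ =>
      deriv Ft ((w : L2 O) z.1 + z.2 * ((u : L2 O) z.1 - (w : L2 O) z.1))
        * ((u : L2 O) z.1 - (w : L2 O) z.1) :=
    ((measurable_deriv Ft).comp (by fun_prop)).mul (by fun_prop)
  have hslice : ∀ s ∈ Set.Ioc (0 : ℝ) 1,
      ∫⁻ x, ‖deriv Ft ((w : L2 O) x + s * ((u : L2 O) x - (w : L2 O) x))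
        * ((u : L2 O) x - (w : L2 O) x)‖ₑ ∂μ
      ≤ ENNReal.ofReal (C * ‖((u - w : E.Hdot1) : L2 O)‖) := by
    intro s hs
    have h1 : ∀ᵐ x ∂μ, ‖deriv Ft ((w : L2 O) x + s * ((u : L2 O) x - (w : L2 O) x))
        * ((u : L2 O) x - (w : L2 O) x)‖ₑ
        = ‖f (w + s • (u - w)) x * ((u : L2 O) - (w : L2 O)) x‖ₑ := by
      filter_upwards [hf (w + s • (u - w)), Lp.coeFn_add (w : L2 O) (s • ((u : L2 O) - (w : L2 O))),
        Lp.coeFn_smul s ((u : L2 O) - (w : L2 O)), Lp.coeFn_sub (u : L2 O) (w : L2 O)]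
        with x h1 h2 h3 h4
      rw [h1, Submodule.coe_add, Submodule.coe_smul, Submodule.coe_sub, h2, Pi.add_apply, h3,
        Pi.smul_apply, h4, Pi.sub_apply, smul_eq_mul]
    rw [lintegral_congr_ae h1]
    refine (lintegral_enorm_mul_le _ _).trans (ENNReal.ofReal_le_ofReal ?_)
    exact mul_le_mul_of_nonneg_right (hC s hs) (norm_nonneg _)
  have hmain : ‖potential Ft u - potential Ft w‖ₑ
      ≤ ENNReal.ofReal (C * ‖((u - w : E.Hdot1) : L2 O)‖) := by
    calc ‖potential Ft u - potential Ft w‖ₑ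
        = ‖∫ x, (Ft ((u : L2 O) x) - Ft ((w : L2 O) x)) ∂μ‖ₑ := by
          rw [integral_sub (hint u) (hint w)]
          rfl
      _ ≤ ∫⁻ x, ‖Ft ((u : L2 O) x) - Ft ((w : L2 O) x)‖ₑ ∂μ :=
          enorm_integral_le_lintegral_enorm _
      _ ≤ ∫⁻ x, (∫⁻ s in Set.Ioc (0 : ℝ) 1,
            ‖deriv Ft ((w : L2 O) x + s * ((u : L2 O) x - (w : L2 O) x))
              * ((u : L2 O) x - (w : L2 O) x)‖ₑ) ∂μ :=
          lintegral_mono fun x => enorm_sub_le_lintegral_deriv_segment hF _ _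
      _ = ∫⁻ s in Set.Ioc (0 : ℝ) 1, ∫⁻ x,
            ‖deriv Ft ((w : L2 O) x + s * ((u : L2 O) x - (w : L2 O) x))
              * ((u : L2 O) x - (w : L2 O) x)‖ₑ ∂μ :=
          lintegral_lintegral_swap hm.enorm.aemeasurable
      _ ≤ ∫⁻ _ in Set.Ioc (0 : ℝ) 1, ENNReal.ofReal (C * ‖((u - w : E.Hdot1) : L2 O)‖) :=
          setLIntegral_mono measurable_const hslice
      _ = _ := by simp
  rw [← ofReal_norm, ENNReal.ofReal_le_ofReal_iff (by positivity)] at hmain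
  exact hmain

/-- The polynomial with the absolute values of the coefficients of `b`. -/
def absPoly (b : Polynomial ℝ) : Polynomial ℝ :=
  ∑ i ∈ Finset.range (b.natDegree + 1), Polynomial.C |b.coeff i| * Polynomial.X ^ i

theorem eval_absPoly (b : Polynomial ℝ) (x : ℝ) :
    (absPoly b).eval x = ∑ i ∈ Finset.range (b.natDegree + 1), |b.coeff i| * x ^ i := by
  simp [absPoly, Polynomial.eval_finsetSum]

theorem eval_le_eval_absPoly (b : Polynomial ℝ) {x y : ℝ} (hx : 0 ≤ x) (hxy : x ≤ y) :
    b.eval x ≤ (absPoly b).eval y := by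
  rw [eval_absPoly, Polynomial.eval_eq_sum_range]
  refine Finset.sum_le_sum fun i _ => ?_
  exact mul_le_mul (le_abs_self _) (pow_le_pow_left₀ hx hxy i) (by positivity) (abs_nonneg _)

end Potential

/-! ### Consequences of the assumptions on the coefficients -/

section Coefficients

variable {d : ℕ} {O : Set (EuclideanSpace ℝ (Fin d))} {E : DirichletEigenpairs O}
  {R : Covariance E}

theorem trace_eq_tsum (T : R.HS) : R.trace T = ∑' k, ‖T.1 (R.rootMk (E.basis k))‖ ^ 2 := by
  simp only [Covariance.trace, real_inner_self_eq_norm_sq]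

theorem trace_nonneg (T : R.HS) : 0 ≤ R.trace T := by
  rw [trace_eq_tsum]
  exact tsum_nonneg fun _ => sq_nonneg _

theorem ofReal_trace (T : R.HS) :
    ENNReal.ofReal (R.trace T) = ∑' k, ‖T.1 (R.rootMk (E.basis k))‖ₑ ^ 2 := by
  simp_rw [trace_eq_tsum, enorm_sq_eq_ofReal_norm_sq]
  exact ENNReal.ofReal_tsum_of_nonneg (fun _ => sq_nonneg _) T.2.2

theorem hsNorm_sq (T : R.HS) : R.hsNorm T ^ 2 = R.trace T := Real.sq_sqrt (trace_nonneg T)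

theorem norm_apply_basis_le_hsNorm (T : R.HS) (k : ℕ) :
    ‖T.1 (R.rootMk (E.basis k))‖ ≤ R.hsNorm T := by
  refine Real.le_sqrt_of_sq_le ?_
  rw [trace_eq_tsum]
  exact T.2.2.le_tsum k fun _ _ => sq_nonneg _

theorem continuous_eval_pair (b : MvPolynomial (Fin 2) ℝ) :
    Continuous fun z : ℝ × ℝ => MvPolynomial.eval ![z.1, z.2] b :=
  (MvPolynomial.continuous_eval b).comp (by fun_prop)

variable {Ft : ℝ → ℝ} {f : E.Hdot1 → L2 O} {g : E.Hdot1 × (Fin d → L2 O) → R.HS} {k : ℕ} {δ : ℝ}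

theorem Coefficients.energyContinuous_f (h : Coefficients R Ft f g k δ) :
    EnergyContinuous E f := by
  obtain ⟨b, -, hb⟩ := h.f_lipschitz
  exact energyContinuous_of_norm_sub_le E
    (B := fun x y => MvPolynomial.eval ![x, y] b) (continuous_eval_pair b) hb

theorem Coefficients.energyContinuous_g (h : Coefficients R Ft f g k δ) (i : ℕ) :
    EnergyContinuous E fun u => (g (E.theta u)).1 (R.rootMk (E.basis i)) := by
  obtain ⟨b, -, hb⟩ := h.g_lipschitz
  refine energyContinuous_of_norm_sub_le E
    (B := fun x y => MvPolynomial.eval ![x, y] b) (continuous_eval_pair b) fun u w => ?_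
  exact (norm_apply_basis_le_hsNorm (g (E.theta u) - g (E.theta w)) i).trans (hb u w)

theorem Coefficients.exists_abs_potential_sub_le (h : Coefficients R Ft f g k δ) :
    ∃ b : Polynomial ℝ, ∀ u w : E.Hdot1, |potential Ft u - potential Ft w|
      ≤ b.eval (E.hNorm u + E.hNorm w) * E.hNorm (u - w) := by
  obtain ⟨b, -, hb⟩ := h.f_growth
  obtain ⟨C, hC0, hC⟩ := norm_le_mul_hNorm E
  -- The growth polynomial need not be monotone. `absPoly b` majorises it and is increasing on `[0,
  -- ∞)`; `C` is the Poincaré constant.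
  refine ⟨absPoly b * Polynomial.C C, fun u w => ?_⟩
  have hbound : ∀ s ∈ Set.Ioc (0 : ℝ) 1,
      ‖f (w + s • (u - w))‖ ≤ (absPoly b).eval (E.hNorm u + E.hNorm w) := by
    rintro s ⟨hs0, hs1⟩
    refine (hb _).trans (eval_le_eval_absPoly b (hNorm_nonneg E _) ?_)
    have h1 : w + s • (u - w) = s • u + (1 - s) • w := by
      rw [smul_sub, sub_smul, one_smul]
      abel
    rw [h1]
    refine (hNorm_add_le E _ _).trans ?_
    rw [hNorm_smul, hNorm_smul, abs_of_pos hs0, abs_of_nonneg (by linarith)]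
    have := hNorm_nonneg E u
    have := hNorm_nonneg E w
    nlinarith
  refine (abs_potential_sub_le h.differentiable h.f_eq h.integrable hbound).trans ?_
  rw [Polynomial.eval_mul, Polynomial.eval_C, mul_assoc]
  refine mul_le_mul_of_nonneg_left (hC _) ((norm_nonneg _).trans (hbound 1 (by simp)))

theorem Coefficients.energyContinuous_potential (h : Coefficients R Ft f g k δ) :
    EnergyContinuous E fun u => potential Ft u := by
  obtain ⟨b, hb⟩ := h.exists_abs_potential_sub_le
  exact energyContinuous_of_norm_sub_le E (B := fun x y => b.eval (x + y))
    (b.continuous.comp (by fun_prop)) hb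

theorem Coefficients.exists_potential_le (h : Coefficients R Ft f g k δ) :
    ∃ b : Polynomial ℝ, ∀ u : E.Hdot1, potential Ft u + δ ≤ b.eval (E.hNorm u) := by
  obtain ⟨b, hb⟩ := h.exists_abs_potential_sub_le
  refine ⟨Polynomial.C (potential Ft (0 : E.Hdot1) + δ) + b * Polynomial.X, fun u => ?_⟩
  have h1 := (abs_le.1 (hb u 0)).2
  rw [hNorm_zero, sub_zero, add_zero] at h1
  simp only [Polynomial.eval_add, Polynomial.eval_C, Polynomial.eval_mul, Polynomial.eval_X]
  linarith

/-- The square of the `L^{2k+2}` term in the growth bound of `g` is exactly the power controlled by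
coercivity, and the potential grows polynomially in the `Ḣ¹` norm. No separate Sobolev inequality
enters. -/
theorem Coefficients.exists_trace_le (h : Coefficients R Ft f g k δ) :
    ∃ b : Polynomial ℝ, ∀ u : E.Hdot1, R.trace (g (E.theta u)) ≤ b.eval (E.hNorm u) := by
  obtain ⟨b, hb⟩ := h.exists_potential_le
  obtain ⟨c₂, hc₂, hg⟩ := h.g_growth
  obtain ⟨c₃, c₄, hc₃, hc₄, hco⟩ := h.coercive
  refine ⟨Polynomial.C (3 * c₂ ^ 2) * (1 + Polynomial.C c₄⁻¹ * b + Polynomial.X ^ 2), fun u => ?_⟩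
  simp only [Polynomial.eval_add, Polynomial.eval_C, Polynomial.eval_mul, Polynomial.eval_X,
    Polynomial.eval_one, Polynomial.eval_pow]
  have hg := hg u
  have hco := (hco u).2
  have hb := hb u
  set x := (eLpNorm (u : L2 O) (2 * k + 2) (volume.restrict O)).toReal
  have hx : 0 ≤ x := ENNReal.toReal_nonneg
  have hy := hNorm_nonneg E u
  set y := E.hNorm u
  have hL : (x ^ (k + 1)) ^ 2 ≤ c₄⁻¹ * b.eval y := by
    rw [← pow_mul, inv_mul_eq_div, le_div_iff₀' hc₄, show (k + 1) * 2 = 2 * k + 2 by ring]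
    have := mul_nonneg hc₃.le (sq_nonneg ‖(u : L2 O)‖)
    linarith
  have hL0 : 0 ≤ x ^ (k + 1) := by positivity
  set z := x ^ (k + 1)
  rw [← hsNorm_sq]
  calc R.hsNorm (g (E.theta u)) ^ 2 ≤ (c₂ * (1 + z + y)) ^ 2 :=
        pow_le_pow_left₀ (Real.sqrt_nonneg _) hg 2
    _ = c₂ ^ 2 * (1 + z + y) ^ 2 := by ring
    _ ≤ c₂ ^ 2 * (3 * (1 + z ^ 2 + y ^ 2)) := by
        refine mul_le_mul_of_nonneg_left ?_ (sq_nonneg _)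
        nlinarith [sq_nonneg (1 - z), sq_nonneg (1 - y), sq_nonneg (z - y)]
    _ ≤ 3 * c₂ ^ 2 * (1 + c₄⁻¹ * b.eval y + y ^ 2) := by
        nlinarith [sq_nonneg c₂]

end Coefficients

/-! ### Random variables with moments of all orders -/

section Moments

variable {Ω : Type*} {mΩ : MeasurableSpace Ω} {P : Measure Ω}

/-- All absolute moments of the real random variable `Y` are finite. -/
def AllMoments (Y : Ω → ℝ) (P : Measure Ω) : Prop :=
  AEStronglyMeasurable Y P ∧ ∀ p : ℕ, Integrable (fun ω => |Y ω| ^ p) P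

theorem AllMoments.mono {X Y : Ω → ℝ} (hY : AllMoments Y P) (hX : AEStronglyMeasurable X P)
    (h : ∀ᵐ ω ∂P, |X ω| ≤ Y ω) : AllMoments X P := by
  refine ⟨hX, fun p => (hY.2 p).mono' (hX.norm.pow p) ?_⟩
  filter_upwards [h] with ω hω
  rw [Real.norm_eq_abs, abs_pow, abs_abs]
  exact pow_le_pow_left₀ (abs_nonneg _) (hω.trans (le_abs_self _)) p

theorem AllMoments.integrable {Y : Ω → ℝ} (hY : AllMoments Y P) : Integrable Y P := by
  refine (hY.2 1).mono' hY.1 (ae_of_all _ fun ω => ?_)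
  simp

theorem allMoments_const [IsFiniteMeasure P] (c : ℝ) : AllMoments (fun _ : Ω => c) P :=
  ⟨aestronglyMeasurable_const, fun _ => integrable_const _⟩

theorem AllMoments.add {X Y : Ω → ℝ} (hX : AllMoments X P) (hY : AllMoments Y P) :
    AllMoments (fun ω => X ω + Y ω) P := by
  refine ⟨hX.1.add hY.1, fun p => ?_⟩
  refine (((hX.2 p).add (hY.2 p)).const_mul (2 ^ (p - 1))).mono' ((hX.1.add hY.1).norm.pow p)
    (ae_of_all _ fun ω => ?_)
  rw [Real.norm_eq_abs, abs_pow, abs_abs]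
  exact (pow_le_pow_left₀ (abs_nonneg _) (abs_add_le _ _) p).trans
    (add_pow_le (abs_nonneg _) (abs_nonneg _) p)

theorem AllMoments.mul {X Y : Ω → ℝ} (hX : AllMoments X P) (hY : AllMoments Y P) :
    AllMoments (fun ω => X ω * Y ω) P := by
  refine ⟨hX.1.mul hY.1, fun p => ?_⟩
  refine ((hX.2 (p * 2)).add (hY.2 (p * 2))).mono' ((hX.1.mul hY.1).norm.pow p)
    (ae_of_all _ fun ω => ?_)
  rw [Pi.add_apply, Real.norm_eq_abs, abs_pow, abs_abs, abs_mul, mul_pow, pow_mul, pow_mul]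
  nlinarith [sq_nonneg (|X ω| ^ p - |Y ω| ^ p), sq_nonneg (|X ω| ^ p), sq_nonneg (|Y ω| ^ p)]

theorem AllMoments.polynomial_eval [IsFiniteMeasure P] {X : Ω → ℝ} (hX : AllMoments X P)
    (b : Polynomial ℝ) : AllMoments (fun ω => b.eval (X ω)) P := by
  induction b using Polynomial.induction_on' with
  | add b c hb hc =>
    simp only [Polynomial.eval_add]
    exact hb.add hc
  | monomial n c =>
    simp only [Polynomial.eval_monomial]
    refine (allMoments_const c).mul ?_
    induction n with
    | zero => simpa using allMoments_const (P := P) 1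
    | succ n ih =>
      simp only [pow_succ]
      exact ih.mul hX

theorem AllMoments.lintegral_ofReal_pow_lt_top {X : Ω → ℝ} (hX : AllMoments X P) (p : ℕ) :
    ∫⁻ ω, ENNReal.ofReal (X ω) ^ p ∂P < ∞ := by
  refine lt_of_le_of_lt (lintegral_mono fun ω => ?_) (hX.2 p).2
  rw [← ofReal_norm, Real.norm_of_nonneg (by positivity), ENNReal.ofReal_pow (abs_nonneg _)]
  gcongr
  exact le_abs_self _

theorem allMoments_of_lintegral [IsFiniteMeasure P] {X : Ω → ℝ} (hX : AEStronglyMeasurable X P)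
    (h : ∀ p : ℕ, 1 ≤ p → ∫⁻ ω, ‖X ω‖ₑ ^ p ∂P < ∞) : AllMoments X P := by
  refine ⟨hX, fun p => ?_⟩
  rcases Nat.eq_zero_or_pos p with rfl | hp
  · simp
  refine ⟨hX.norm.pow p, ?_⟩
  refine lt_of_eq_of_lt (lintegral_congr fun ω => ?_) (h p hp)
  rw [enorm_pow, ← Real.norm_eq_abs, enorm_norm]

end Moments

/-! ### Brownian increments -/

section BrownianIncrements

variable {Ω : Type*} {mΩ : MeasurableSpace Ω} {P : Measure Ω} {ℱ : Filtration ℝ≥0 mΩ}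
  {β : ℕ → ℝ≥0 → Ω → ℝ}

theorem IsBrownianSequence.measurable_increment (hβ : IsBrownianSequence P ℱ β) {s t : ℝ≥0}
    (hst : s ≤ t) (k : ℕ) : Measurable[ℱ t] fun ω => β k t ω - β k s ω :=
  (hβ.adapted k t).sub ((hβ.adapted k s).mono (ℱ.mono hst) le_rfl)

theorem IsBrownianSequence.iIndepFun_increment (hβ : IsBrownianSequence P ℱ β) (s t : ℝ≥0) :
    iIndepFun (fun k ω => β k t ω - β k s ω) P :=
  hβ.indep.comp (fun _ p => p t - p s) fun _ => by fun_prop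

theorem IsBrownianSequence.hasLaw_increment (hβ : IsBrownianSequence P ℱ β) (s h : ℝ≥0) (k : ℕ) :
    HasLaw (fun ω => β k (s + h) ω - β k s ω) (gaussianReal 0 h) P := by
  have h1 := (hβ.brownian k).toIsPreBrownianReal.hasLaw_sub (s + h) s
  have h2 : nndist ((s + h : ℝ≥0) : ℝ) (s : ℝ) = h := by
    ext
    simp
  rwa [show nndist (s + h).1 s.1 = h from h2] at h1

end BrownianIncrements

instance instSecondCountableTopologyL2 {d : ℕ} (O : Set (EuclideanSpace ℝ (Fin d))) :
    SecondCountableTopology (L2 O) :=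
  have : Fact ((2 : ℝ≥0∞) ≠ ∞) := ⟨by simp⟩
  Lp.SecondCountableTopology

/-! ### Measurability of one implicit step -/

section Adaptedness

variable {d : ℕ} {O : Set (EuclideanSpace ℝ (Fin d))} {E : DirichletEigenpairs O}
  {Ω : Type*} {m mΩ : MeasurableSpace Ω} {P : Measure Ω}

theorem exists_coefStep (E : DirichletEigenpairs O) (σ : Scheme) {τ : ℝ} (hτ : 0 < τ) :
    ∃ p r κ p' r' κ' : ℕ → ℝ, (∃ B, ∀ i, 0 ≤ κ i ∧ κ i ≤ B) ∧
      ∀ (Ft : ℝ → ℝ) (f : E.Hdot1 → L2 O) (δ : ℝ) (hat : E.Hdot1) (G : L2 O)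
        (u u' : E.Hdot1) (v v' : L2 O) (q q' : ℝ),
        σ.Step Ft f δ τ hat G u u' v v' q q' →
        CoefStep E p r κ p' r' κ' G (savForce Ft f δ hat q q') u u' v v' := by
  cases σ
  · exact exists_coefStep_midpoint E hτ
  · exact exists_coefStep_exponential E τ

theorem Scheme.Step.auxStep {σ : Scheme} {Ft : ℝ → ℝ} {f : E.Hdot1 → L2 O} {δ τ : ℝ}
    {hat u u' : E.Hdot1} {G v v' : L2 O} {q q' : ℝ}
    (h : σ.Step Ft f δ τ hat G u u' v v' q q') : AuxStep Ft f δ hat u u' q q' := by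
  cases σ
  · exact h.2.2
  · exact h.2

theorem aestronglyMeasurable_hat (χ : Extrapolation) {u : ℕ → Ω → E.Hdot1} {n : ℕ}
    (hu : ∀ l ≤ n, AEStronglyMeasurable[m] (fun ω => (u l ω : L2 O)) P) :
    AEStronglyMeasurable[m] (fun ω => (χ.hat (fun l => u l ω) n : L2 O)) P := by
  cases χ
  · exact hu n le_rfl
  · simp only [Extrapolation.hat, Submodule.coe_smul, Submodule.coe_sub]
    exact (((hu n le_rfl).const_smul (3 : ℝ)).sub
      (hu (n - 1) (Nat.sub_le n 1))).const_smul (1 / 2 : ℝ)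

theorem aestronglyMeasurable_step {p r κ p' r' κ' : ℕ → ℝ} {B : ℝ}
    (hκ : ∀ i, 0 ≤ κ i ∧ κ i ≤ B) {Ft : ℝ → ℝ} {f : E.Hdot1 → L2 O} {δ : ℝ}
    (hf : EnergyContinuous E f) (hF : EnergyContinuous E fun u => potential Ft u)
    (hpos : ∀ u : E.Hdot1, 0 < potential Ft u + δ)
    {hat u u' : Ω → E.Hdot1} {v v' G : Ω → L2 O} {q q' : Ω → ℝ}
    (hhat : AEStronglyMeasurable[m] (fun ω => (hat ω : L2 O)) P)
    (hu : AEStronglyMeasurable[m] (fun ω => (u ω : L2 O)) P) (hv : AEStronglyMeasurable[m] v P)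
    (hG : AEStronglyMeasurable[m] G P) (hq : AEStronglyMeasurable[m] q P)
    (hstep : ∀ᵐ ω ∂P, CoefStep E p r κ p' r' κ' (G ω)
      (savForce Ft f δ (hat ω) (q ω) (q' ω)) (u ω) (u' ω) (v ω) (v' ω))
    (haux : ∀ᵐ ω ∂P, AuxStep Ft f δ (hat ω) (u ω) (u' ω) (q ω) (q' ω)) :
    AEStronglyMeasurable[m] (fun ω => (u' ω : L2 O)) P ∧ AEStronglyMeasurable[m] v' P ∧
      AEStronglyMeasurable[m] q' P := by
  have hfm := aestronglyMeasurable_energyContinuous_comp E hf hhat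
  have hFm := aestronglyMeasurable_energyContinuous_comp E hF hhat
  have hs : AEStronglyMeasurable[m] (fun ω => √(potential Ft (hat ω) + δ)) P := by fun_prop
  have hw : AEStronglyMeasurable[m] (fun ω => v ω + G ω) P := hv.add hG
  have hx := fun i => aestronglyMeasurable_coef E hfm i
  have hui := fun i => aestronglyMeasurable_coef E hu i
  have hwi := fun i => aestronglyMeasurable_coef E hw i
  -- The auxiliary variable comes first: the force contains `q'`, and `u'`, `v'` are explicit only
  -- once it is known.
  have hq' : AEStronglyMeasurable[m] q' P := by
    refine aestronglyMeasurable_of_tendsto_ae_sub (f := fun M ω => auxTruncation E p r κ M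
      √(potential Ft (hat ω) + δ) (f (hat ω)) (u ω : L2 O) (v ω + G ω) (q ω)) (fun M => ?_) ?_
    · have hD := aestronglyMeasurable_fun_sum_sub (P := P) (m := m) (f := fun i ω =>
        E.coef i (f (hat ω)) * (p i * E.coef i (u ω : L2 O) + r i * E.coef i (v ω + G ω)
          - E.coef i (u ω : L2 O))) (Finset.range M)
        fun i => (hx i).mul ((((hui i).const_mul _).add ((hwi i).const_mul _)).sub (hui i))
      have hK := aestronglyMeasurable_fun_sum_sub (P := P) (m := m) (f := fun i ω =>
        κ i * E.coef i (f (hat ω)) ^ 2) (Finset.range M) fun i => ((hx i).pow 2).const_mul _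
      have h4s : AEStronglyMeasurable[m] (fun ω => 4 * √(potential Ft (hat ω) + δ) ^ 2) P :=
        (hs.pow 2).const_mul _
      exact ((hq.add (hD.div₀ (hs.const_mul 2))).sub ((hq.mul hK).div₀ h4s)).div₀
        (aestronglyMeasurable_const.add (hK.div₀ h4s))
    · filter_upwards [hstep, haux] with ω h1 h2
      exact tendsto_auxTruncation hκ h1 h2 (hpos _)
  have hb : ∀ i, AEStronglyMeasurable[m]
      (fun ω => E.coef i (savForce Ft f δ (hat ω) (q ω) (q' ω))) P := fun i => by
    simp only [savForce, coef_smul]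
    exact (((hq.add hq').div₀ aestronglyMeasurable_const).div₀ hs).mul (hx i)
  refine ⟨aestronglyMeasurable_of_coef E fun i => ?_, aestronglyMeasurable_of_coef E fun i => ?_,
    hq'⟩
  · refine ((((hui i).const_mul (p i)).add ((hwi i).const_mul (r i))).sub
      ((hb i).const_mul (κ i))).congr ?_
    filter_upwards [hstep] with ω h
    exact (h.coef_fst i).symm
  · refine ((((hui i).const_mul (p' i)).add ((hwi i).const_mul (r' i))).sub
      ((hb i).const_mul (κ' i))).congr ?_
    filter_upwards [hstep] with ω h
    exact (h.coef_snd i).symm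

end Adaptedness

/-! ### Adaptedness, the energy law and moments along the scheme -/

section Law

variable {d : ℕ} {O : Set (EuclideanSpace ℝ (Fin d))} {E : DirichletEigenpairs O}
  {R : Covariance E} {Ft : ℝ → ℝ} {f : E.Hdot1 → L2 O}
  {g : E.Hdot1 × (Fin d → L2 O) → R.HS} {k : ℕ} {δ : ℝ}
  {Ω : Type*} {mΩ : MeasurableSpace Ω} {P : Measure Ω}

theorem ofReal_modEnergy (u : E.Hdot1) (x : L2 O) (q : ℝ) :
    ENNReal.ofReal (modEnergy E u x q)
      = ENNReal.ofReal (1 / 2 * E.hNorm u ^ 2 + q ^ 2) + ENNReal.ofReal (1 / 2) * ‖x‖ₑ ^ 2 := by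
  rw [enorm_sq_eq_ofReal_norm_sq, ← ENNReal.ofReal_mul (by norm_num),
    ← ENNReal.ofReal_add (by positivity) (by positivity), modEnergy]
  ring_nf

theorem modEnergy_nonneg (u : E.Hdot1) (x : L2 O) (q : ℝ) : 0 ≤ modEnergy E u x q := by
  rw [modEnergy]
  positivity

theorem aestronglyMeasurable_trace {m : MeasurableSpace Ω} (h : Coefficients R Ft f g k δ)
    {u : Ω → E.Hdot1} (hu : AEStronglyMeasurable[m] (fun ω => (u ω : L2 O)) P) :
    AEStronglyMeasurable[m] (fun ω => R.trace (g (E.theta (u ω)))) P := by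
  refine aestronglyMeasurable_of_tendsto_ae_sub (f := fun M ω => ∑ i ∈ Finset.range M,
    ‖(g (E.theta (u ω))).1 (R.rootMk (E.basis i))‖ ^ 2) (fun M => ?_) (ae_of_all _ fun ω => ?_)
  · refine aestronglyMeasurable_fun_sum_sub _ fun i => ?_
    exact (continuous_norm.pow 2).comp_aestronglyMeasurable
      (aestronglyMeasurable_energyContinuous_comp E (h.energyContinuous_g i) hu)
  · rw [trace_eq_tsum]
    exact (g (E.theta (u ω))).2.2.hasSum.tendsto_sum_nat

variable {ℱ : Filtration ℝ≥0 mΩ} {β : ℕ → ℝ≥0 → Ω → ℝ} {N : ℕ} {τ : ℝ≥0}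
  {u₀ : Ω → E.Hdot1} {v₀ : Ω → L2 O} {σ : Scheme} {χ : Extrapolation}
  {u : ℕ → Ω → E.Hdot1} {v : ℕ → Ω → L2 O} {q : ℕ → Ω → ℝ}

/-- All earlier `u l` are carried through the induction because the extrapolated argument involves
`u (n - 1)`. -/
theorem IsSAVSolution.aestronglyMeasurable (hcoef : Coefficients R Ft f g k δ)
    (hpos : ∀ u : E.Hdot1, 0 < potential Ft u + δ) (hβ : IsBrownianSequence P ℱ β) (hτ : 0 < τ)
    (hu₀ : AEStronglyMeasurable[ℱ 0] (fun ω => (u₀ ω : L2 O)) P)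
    (hv₀ : AEStronglyMeasurable[ℱ 0] v₀ P)
    (hsol : IsSAVSolution R σ χ Ft f g δ P β N τ u₀ v₀ u v q) {n : ℕ} (hn : n ≤ N) :
    (∀ l ≤ n, AEStronglyMeasurable[ℱ (n * τ)] (fun ω => (u l ω : L2 O)) P) ∧
      AEStronglyMeasurable[ℱ (n * τ)] (v n) P ∧ AEStronglyMeasurable[ℱ (n * τ)] (q n) P := by
  obtain ⟨p, r, κ, p', r', κ', ⟨B, hκ⟩, hcs⟩ :=
    exists_coefStep E σ (τ := (τ : ℝ)) (by exact_mod_cast hτ)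
  induction n with
  | zero =>
    rw [Nat.cast_zero, zero_mul]
    refine ⟨fun l hl => ?_, hv₀.congr ?_, ?_⟩
    · obtain rfl := Nat.le_zero.1 hl
      refine hu₀.congr ?_
      filter_upwards [hsol.init] with ω hω
      rw [hω.1]
    · filter_upwards [hsol.init] with ω hω
      exact hω.2.1.symm
    · have h1 := aestronglyMeasurable_energyContinuous_comp E hcoef.energyContinuous_potential hu₀
      have h2 : AEStronglyMeasurable[ℱ 0] (fun ω => √(potential Ft (u₀ ω) + δ)) P := by fun_prop
      refine h2.congr ?_
      filter_upwards [hsol.init] with ω hω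
      exact hω.2.2.symm
  | succ n ih =>
    obtain ⟨hu, hv, hq⟩ := ih (by lia)
    obtain ⟨G, hG, hstep⟩ := hsol.step n (by lia)
    have hle : (n : ℝ≥0) * τ ≤ ((n + 1 : ℕ) : ℝ≥0) * τ := by
      gcongr
      simp
    have hmono := ℱ.mono hle
    have hGm : AEStronglyMeasurable[ℱ ((n + 1 : ℕ) * τ)] G P := by
      refine aestronglyMeasurable_noise (P := P)
        (ξ := fun i ω => β i ((n + 1 : ℕ) * τ) ω - β i (n * τ) ω)
        (a := fun i ω => (g (E.theta (u n ω))).1 (R.rootMk (E.basis i)))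
        (hβ.measurable_increment hle) (fun i => ?_) ?_
      · exact (aestronglyMeasurable_energyContinuous_comp E (hcoef.energyContinuous_g i)
          (hu n le_rfl)).mono hmono
      · simpa [IsNoiseTerm] using hG
    have hu' := fun l hl => (hu l hl).mono hmono
    obtain ⟨h1, h2, h3⟩ := aestronglyMeasurable_step (m := ℱ ((n + 1 : ℕ) * τ)) hκ
      hcoef.energyContinuous_f hcoef.energyContinuous_potential hpos
      (aestronglyMeasurable_hat χ hu') (hu' n le_rfl) (hv.mono hmono) hGm (hq.mono hmono)
      (hstep.mono fun ω h => hcs _ _ _ _ _ _ _ _ _ _ _ h) (hstep.mono fun ω h => h.auxStep)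
    refine ⟨fun l hl => ?_, h2, h3⟩
    rcases Nat.le_succ_iff.1 hl with hl | rfl
    · exact hu' l hl
    · exact h1

theorem IsSAVSolution.exists_energy_step [IsProbabilityMeasure P]
    (hcoef : Coefficients R Ft f g k δ)
    (hpos : ∀ u : E.Hdot1, 0 < potential Ft u + δ) (hβ : IsBrownianSequence P ℱ β) (hτ : 0 < τ)
    (hu₀ : AEStronglyMeasurable[ℱ 0] (fun ω => (u₀ ω : L2 O)) P)
    (hv₀ : AEStronglyMeasurable[ℱ 0] v₀ P)
    (hsol : IsSAVSolution R σ χ Ft f g δ P β N τ u₀ v₀ u v q) {n : ℕ} (hn : n < N) :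
    ∃ G : Ω → L2 O, AEStronglyMeasurable G P ∧
      (∀ᵐ ω ∂P, modEnergy E (u (n + 1) ω) (v (n + 1) ω) (q (n + 1) ω)
        = modEnergy E (u n ω) (v n ω + G ω) (q n ω)) ∧
      ∫⁻ ω, ‖v n ω + G ω‖ₑ ^ 2 ∂P = ∫⁻ ω, ‖v n ω‖ₑ ^ 2 ∂P
        + τ * ∫⁻ ω, ENNReal.ofReal (R.trace (g (E.theta (u n ω)))) ∂P ∧
      ∀ p : ℕ, 1 ≤ p → ∫⁻ ω, ‖‖G ω‖ ^ 2‖ₑ ^ p ∂P ≤ (τ * gaussianSqNorm p) ^ p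
        * ∫⁻ ω, ENNReal.ofReal (R.trace (g (E.theta (u n ω)))) ^ p ∂P := by
  obtain ⟨p, r, κ, p', r', κ', -, hcs⟩ :=
    exists_coefStep E σ (τ := (τ : ℝ)) (by exact_mod_cast hτ)
  obtain ⟨hu, hv, hq⟩ := hsol.aestronglyMeasurable hcoef hpos hβ hτ hu₀ hv₀ hn.le
  obtain ⟨G, hG, hstep⟩ := hsol.step n hn
  have ht : ((n : ℝ≥0) + 1) * τ = n * τ + τ := by ring
  rw [IsNoiseTerm, ht] at hG
  have hle : (n : ℝ≥0) * τ ≤ n * τ + τ := by simp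
  have ha := fun i => aestronglyMeasurable_energyContinuous_comp E (hcoef.energyContinuous_g i)
    (hu n le_rfl)
  have hξ : ∀ i, Measurable fun ω => β i (n * τ + τ) ω - β i (n * τ) ω := fun i =>
    (hβ.measurable_increment hle i).mono (ℱ.le _) le_rfl
  have hind := hβ.iIndepFun_increment (n * τ) (n * τ + τ)
  have hlaw := hβ.hasLaw_increment (n * τ) τ
  have hpast := hβ.indep_past (n * τ) (n * τ + τ) hle
  simp only [ofReal_trace]
  refine ⟨G, ?_, ?_, ?_, ?_⟩
  · exact aestronglyMeasurable_noise hξ (fun i => (ha i).mono (ℱ.le _)) hG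
  · filter_upwards [hstep] with ω h
    exact modEnergy_step (hcs _ _ _ _ _ _ _ _ _ _ _ h) h.auxStep (hpos _)
  · refine lintegral_enorm_add_noise_sq E.basis (ℱ.le (n * τ)) hξ hind hlaw hpast hv ha
      (ae_of_all _ fun ω => ?_) hG
    rw [← ofReal_trace]
    exact ENNReal.ofReal_ne_top
  · exact fun p hp => lintegral_noise_sq_pow_le E.basis (ℱ.le (n * τ)) hξ hind hlaw hpast ha hG hp

theorem IsSAVSolution.lintegral_modEnergy_succ [IsProbabilityMeasure P]
    (hcoef : Coefficients R Ft f g k δ)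
    (hpos : ∀ u : E.Hdot1, 0 < potential Ft u + δ) (hβ : IsBrownianSequence P ℱ β) (hτ : 0 < τ)
    (hu₀ : AEStronglyMeasurable[ℱ 0] (fun ω => (u₀ ω : L2 O)) P)
    (hv₀ : AEStronglyMeasurable[ℱ 0] v₀ P)
    (hsol : IsSAVSolution R σ χ Ft f g δ P β N τ u₀ v₀ u v q) {n : ℕ} (hn : n < N) :
    ∫⁻ ω, ENNReal.ofReal (modEnergy E (u (n + 1) ω) (v (n + 1) ω) (q (n + 1) ω)) ∂P
      = ∫⁻ ω, ENNReal.ofReal (modEnergy E (u n ω) (v n ω) (q n ω)) ∂P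
        + ENNReal.ofReal (τ / 2) *
          ∫⁻ ω, ENNReal.ofReal (R.trace (g (E.theta (u n ω)))) ∂P := by
  obtain ⟨hu, -, hq⟩ := hsol.aestronglyMeasurable hcoef hpos hβ hτ hu₀ hv₀ hn.le
  obtain ⟨G, -, hV, hG, -⟩ := hsol.exists_energy_step hcoef hpos hβ hτ hu₀ hv₀ hn
  have hA : AEMeasurable
      (fun ω => ENNReal.ofReal (1 / 2 * E.hNorm (u n ω) ^ 2 + q n ω ^ 2)) P := by
    have h1 := (aestronglyMeasurable_energyContinuous_comp E (energyContinuous_hNorm E)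
      (hu n le_rfl)).mono (ℱ.le _)
    have h2 := hq.mono (ℱ.le _)
    exact (((h1.pow 2).const_mul _).add (h2.pow 2)).aemeasurable.ennreal_ofReal
  rw [lintegral_congr_ae (hV.mono fun ω h => congrArg ENNReal.ofReal h)]
  simp only [ofReal_modEnergy]
  rw [lintegral_add_left' hA, lintegral_add_left' hA, lintegral_const_mul' _ _ (by simp),
    lintegral_const_mul' _ _ (by simp), hG, mul_add, add_assoc, ← mul_assoc]
  congr 4
  rw [div_eq_inv_mul (τ : ℝ), ENNReal.ofReal_mul (by norm_num), ENNReal.ofReal_coe_nnreal, one_div]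

theorem IsSAVSolution.allMoments [IsProbabilityMeasure P]
    (hcoef : Coefficients R Ft f g k δ)
    (hpos : ∀ u : E.Hdot1, 0 < potential Ft u + δ) (hβ : IsBrownianSequence P ℱ β) (hτ : 0 < τ)
    (hu₀ : AEStronglyMeasurable[ℱ 0] (fun ω => (u₀ ω : L2 O)) P)
    (hv₀ : AEStronglyMeasurable[ℱ 0] v₀ P)
    (hsol : IsSAVSolution R σ χ Ft f g δ P β N τ u₀ v₀ u v q)
    (hinit : ∀ p : ℕ, Integrable (fun ω => E.hNorm (u₀ ω) ^ p) P
      ∧ Integrable (fun ω => ‖v₀ ω‖ ^ p) P) {n : ℕ} (hn : n ≤ N) :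
    AllMoments (fun ω => modEnergy E (u n ω) (v n ω) (q n ω)) P ∧
      AllMoments (fun ω => R.trace (g (E.theta (u n ω)))) P := by
  have hmeas : ∀ l ≤ N, AEStronglyMeasurable (fun ω => E.hNorm (u l ω)) P ∧
      AEStronglyMeasurable (fun ω => modEnergy E (u l ω) (v l ω) (q l ω)) P ∧
      AEStronglyMeasurable (fun ω => R.trace (g (E.theta (u l ω)))) P := fun l hl => by
    obtain ⟨hu, hv, hq⟩ := hsol.aestronglyMeasurable hcoef hpos hβ hτ hu₀ hv₀ hl
    have h1 := (aestronglyMeasurable_energyContinuous_comp E (energyContinuous_hNorm E)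
      (hu l le_rfl)).mono (ℱ.le _)
    have h2 := hq.mono (ℱ.le _)
    have h3 := hv.mono (ℱ.le _)
    exact ⟨h1, ((((h1.pow 2).const_mul _).add ((h3.norm.pow 2).const_mul _)).add (h2.pow 2)),
      aestronglyMeasurable_trace hcoef ((hu l le_rfl).mono (ℱ.le _))⟩
  have htrace : ∀ l ≤ N, AllMoments (fun ω => modEnergy E (u l ω) (v l ω) (q l ω)) P →
      AllMoments (fun ω => R.trace (g (E.theta (u l ω)))) P := fun l hl hV => by
    obtain ⟨b, hb⟩ := hcoef.exists_trace_le
    have hh : AllMoments (fun ω => E.hNorm (u l ω)) P := by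
      refine ((allMoments_const 1).add ((allMoments_const 2).mul hV)).mono (hmeas l hl).1
        (ae_of_all _ fun ω => ?_)
      rw [abs_of_nonneg (hNorm_nonneg E _), modEnergy]
      nlinarith [sq_nonneg (E.hNorm (u l ω) - 1), sq_nonneg ‖v l ω‖, sq_nonneg (q l ω)]
    refine (hh.polynomial_eval b).mono (hmeas l hl).2.2 (ae_of_all _ fun ω => ?_)
    rw [abs_of_nonneg (trace_nonneg _)]
    exact hb _
  suffices h : AllMoments (fun ω => modEnergy E (u n ω) (v n ω) (q n ω)) P from
    ⟨h, htrace n hn h⟩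
  induction n with
  | zero =>
    obtain ⟨b, hb⟩ := hcoef.exists_potential_le
    have hh : AllMoments (fun ω => E.hNorm (u₀ ω)) P := by
      refine ⟨by simpa using (hinit 1).1.aestronglyMeasurable, fun p => ?_⟩
      simpa only [abs_of_nonneg (hNorm_nonneg E _)] using (hinit p).1
    have hv : AllMoments (fun ω => ‖v₀ ω‖) P := by
      refine ⟨by simpa using (hinit 1).2.aestronglyMeasurable, fun p => ?_⟩
      simpa only [abs_norm] using (hinit p).2
    -- Here `q 0 ^ 2` equals the potential plus `δ`, which `b` bounds polynomially.
    refine (((hh.mul hh).add (hv.mul hv)).add (hh.polynomial_eval b)).mono (hmeas 0 hn).2.1 ?_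
    filter_upwards [hsol.init] with ω hω
    rw [abs_of_nonneg (modEnergy_nonneg _ _ _), modEnergy, hω.1, hω.2.1, hω.2.2,
      Real.sq_sqrt (hpos _).le]
    nlinarith [hb (u₀ ω), sq_nonneg (E.hNorm (u₀ ω)), sq_nonneg ‖v₀ ω‖]
  | succ n ih =>
    have ih := ih (by lia)
    obtain ⟨G, hGm, hV, -, hG⟩ := hsol.exists_energy_step hcoef hpos hβ hτ hu₀ hv₀
      (show n < N by lia)
    have hGmom : AllMoments (fun ω => ‖G ω‖ ^ 2) P := by
      refine allMoments_of_lintegral (hGm.norm.pow 2) fun p hp => (hG p hp).trans_lt ?_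
      exact ENNReal.mul_lt_top (ENNReal.pow_lt_top (ENNReal.mul_lt_top ENNReal.coe_lt_top
        (gaussianSqNorm_lt_top p))) ((htrace n (by lia) ih).lintegral_ofReal_pow_lt_top p)
    -- From `½ ‖v + G‖² ≤ ‖v‖² + ‖G‖²`, the first term being at most twice its share of the old
    -- energy.
    refine (((allMoments_const 2).mul ih).add hGmom).mono (hmeas (n + 1) hn).2.1 ?_
    filter_upwards [hV] with ω hω
    rw [abs_of_nonneg (modEnergy_nonneg _ _ _), hω, modEnergy, modEnergy]
    have h1 := pow_le_pow_left₀ (norm_nonneg _) (norm_add_le (v n ω) (G ω)) 2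
    nlinarith [sq_nonneg (‖v n ω‖ - ‖G ω‖), sq_nonneg (E.hNorm (u n ω)), sq_nonneg (q n ω)]

end Law

end StochWave

end

/-! ### The averaged energy evolution law -/

theorem proposition3p1
    {d : ℕ} (hd : 1 ≤ d) (hd' : d ≤ 3)
    (O : Set (EuclideanSpace ℝ (Fin d))) (hO : IsConvexPolytopeDomain O)
    (E : DirichletEigenpairs O) (R : Covariance E)
    (Ft : ℝ → ℝ) (f : E.Hdot1 → L2 O) (g : E.Hdot1 × (Fin d → L2 O) → R.HS)
    (k : ℕ) (δ : ℝ) (hcoef : Coefficients R Ft f g k δ)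
    (hδ : ∃ c : ℝ, 0 < c ∧ ∀ u : E.Hdot1, c ≤ potential Ft u + δ)
    {Ω : Type*} {mΩ : MeasurableSpace Ω} (P : Measure Ω) [IsProbabilityMeasure P]
    (ℱ : Filtration ℝ≥0 mΩ) (β : ℕ → ℝ≥0 → Ω → ℝ) (hβ : IsBrownianSequence P ℱ β)
    (T : ℝ≥0) (hT : 0 < T) (N : ℕ) (τ : ℝ≥0) (hτ : N * τ = T)
    (u₀ : Ω → E.Hdot1) (v₀ : Ω → L2 O)
    (hu₀ : StronglyMeasurable[ℱ 0] (fun ω => (u₀ ω : L2 O)))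
    (hv₀ : StronglyMeasurable[ℱ 0] v₀)
    (σ : Scheme) (χ : Extrapolation)
    (u : ℕ → Ω → E.Hdot1) (v : ℕ → Ω → L2 O) (q : ℕ → Ω → ℝ)
    (hsol : IsSAVSolution R σ χ Ft f g δ P β N τ u₀ v₀ u v q) :
    -- the law for expectations in `[0, ∞]`, for every initial value
    (∀ n < N,
      ∫⁻ ω, ENNReal.ofReal (modEnergy E (u (n + 1) ω) (v (n + 1) ω) (q (n + 1) ω)) ∂P
        = ∫⁻ ω, ENNReal.ofReal (modEnergy E (u n ω) (v n ω) (q n ω)) ∂P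
          + ENNReal.ofReal (τ / 2) *
            ∫⁻ ω, ENNReal.ofReal (R.trace (g (E.theta (u n ω)))) ∂P) ∧
    -- all expectations are finite if the initial value has moments of all orders
    ((∀ p : ℕ, Integrable (fun ω => E.hNorm (u₀ ω) ^ p) P ∧ Integrable (fun ω => ‖v₀ ω‖ ^ p) P) →
      (∀ n ≤ N, Integrable (fun ω => modEnergy E (u n ω) (v n ω) (q n ω)) P ∧
        Integrable (fun ω => R.trace (g (E.theta (u n ω)))) P) ∧
      ∀ n < N,
        ∫ ω, modEnergy E (u (n + 1) ω) (v (n + 1) ω) (q (n + 1) ω) ∂P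
          = ∫ ω, modEnergy E (u n ω) (v n ω) (q n ω) ∂P
            + (τ : ℝ) / 2 * ∫ ω, R.trace (g (E.theta (u n ω))) ∂P) := by
  have hτ0 : 0 < τ := by
    rcases eq_zero_or_pos τ with rfl | h
    · rw [mul_zero] at hτ
      exact absurd hτ hT.ne
    · exact h
  have hpos : ∀ u : E.Hdot1, 0 < potential Ft u + δ := fun u => by
    obtain ⟨c, hc, h⟩ := hδ
    exact hc.trans_le (h u)
  have hlaw := fun n (hn : n < N) => hsol.lintegral_modEnergy_succ hcoef hpos hβ hτ0
    hu₀.aestronglyMeasurable hv₀.aestronglyMeasurable hn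
  refine ⟨hlaw, fun hinit => ?_⟩
  have hmom := fun n (hn : n ≤ N) => hsol.allMoments hcoef hpos hβ hτ0
    hu₀.aestronglyMeasurable hv₀.aestronglyMeasurable hinit hn
  have hint := fun n (hn : n ≤ N) => And.intro (hmom n hn).1.integrable (hmom n hn).2.integrable
  refine ⟨hint, fun n hn => ?_⟩
  have h := hlaw n hn
  have hV : ∀ l, 0 ≤ᵐ[P] fun ω => modEnergy E (u l ω) (v l ω) (q l ω) := fun l =>
    ae_of_all _ fun ω => modEnergy_nonneg _ _ _
  have htr : 0 ≤ᵐ[P] fun ω => R.trace (g (E.theta (u n ω))) :=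
    ae_of_all _ fun ω => trace_nonneg _
  -- Integrability and nonnegativity turn each term of the identity in `[0, ∞]` into
  -- `ENNReal.ofReal` of a real integral, and `ENNReal.ofReal` is injective on nonnegative reals.
  rw [← ofReal_integral_eq_lintegral_ofReal (hint (n + 1) hn).1 (hV _),
    ← ofReal_integral_eq_lintegral_ofReal (hint n hn.le).1 (hV _),
    ← ofReal_integral_eq_lintegral_ofReal (hint n hn.le).2 htr,
    ← ENNReal.ofReal_mul (by positivity),
    ← ENNReal.ofReal_add (integral_nonneg_of_ae (hV _))
      (mul_nonneg (by positivity) (integral_nonneg_of_ae htr)),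
    ENNReal.ofReal_eq_ofReal_iff (integral_nonneg_of_ae (hV _))
      (add_nonneg (integral_nonneg_of_ae (hV _))
        (mul_nonneg (by positivity) (integral_nonneg_of_ae htr)))] at h
  exact h
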